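/- For $m\ge 0$ let $\mathbb{S}_m$ be the group of permutations of $\{1,\dots,m\}$, and draw $\alpha\in\mathbb{S}_m$ as the directed graph with arrows $i\to\alpha(i)$. The universal $\mathfrak{gl}$-weight system $w_{\mathfrak{gl}}$ assigns to every permutation $\alpha\in\mathbb{S}_m$ ($m\ge 0$) a polynomial in $\mathbb{C}[N,C_1,C_2,\dots]$ and is defined by the following relations. 1. $w_{\mathfrak{gl}}$ is $1$ on the empty permutation, and $w_{\mathfrak{gl}}(\alpha\sqcup\beta)=w_{\mathfrak{gl}}(\alpha)\,w_{\mathfrak{gl}}(\beta)$ for the concatenation $\alpha\sqcup\beta\in\mathbb{S}_{m+n}$ of $\alpha\in\mathbb{S}_m$ and $\beta\in\mathbb{S}_n$. 2. $w_{\mathfrak{gl}}$ of the standard cycle $1\to2\to\dots\to m\to1$ is $C_m$, for $m\ge1$. 3. Let $k,k+1$ be neighboring elements with $\alpha(k)\ne k+1$ and $\alpha(k+1)\ne k$, let $a\to k+1\to b$ and $d\to k\to c$ in $\alpha$, and let $\alpha'=(k\ k{+}1)\,\alpha\,(k\ k{+}1)$. Then $w_{\mathfrak{gl}}(\alpha)-w_{\mathfrak{gl}}(\alpha')=w_{\mathfrak{gl}}(\beta_1)-w_{\mathfrak{gl}}(\beta_2)$,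 where $\beta_1,\beta_2\in\mathbb{S}_{m-1}$ are obtained by replacing $k,k+1$ with a single element $\bullet$ such that $d\to\bullet\to b$, $a\to c$ in $\beta_1$, and $a\to\bullet\to c$, $d\to b$ in $\beta_2$, all other arrows being unchanged. (If $k$ or $k+1$ is a fixed point, this is understood as follows: in $\alpha\circ(k\ k{+}1)$ one deletes $k+1$ for $\beta_1$, respectively $k$ for $\beta_2$, joining the arrow that enters the deleted element with the arrow that leaves it.) 4. If $a\to k+1\to k\to b$ in $\alpha$ with $\alpha(k)\neq k+1$, then, with $\alpha'$ as above, $w_{\mathfrak{gl}}(\alpha)-w_{\mathfrak{gl}}(\alpha')=C_1\,w_{\mathfrak{gl}}(\gamma_1)-N\,w_{\mathfrak{gl}}(\gamma_2)$, where $\gamma_1\in\mathbb{S}_{m-2}$ is obtained by deleting both elements and joining $a\to b$, and $\gamma_2\in\mathbb{S}_{m-1}$ by deleting $k+1$ and joining $a\to k\to b$. The Schur substitution is the homomorphism of $\mathbb{C}[N]$-algebras $\mathbb{C}[N,C_1,C_2,\dots]\to\mathbb{C}[N,S_1,S_2,\dots]$ determined by $$1-Nu-\sum_{k\ge1}C_k\,u^{k+1}=\left(\frac{1-(N+1)u/2}{1-(N-1)u/2}\right)^{N}\frac{1+\sum_{i\ge1}S_i\left(\frac{u}{1-(N-1)u/2}\right)^i}{1+\sum_{i\ge1}S_i\left(\frac{u}{1-(N+1)u/2}\right)^i},$$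 where $f^N=\sum_{j\ge0}\binom Nj(f-1)^j$ for a power series $f$ in $u$ with constant term $1$; it expresses $w_{\mathfrak{gl}}$ through the one-part Schur polynomials $S_k$. **Corollary.** There is exactly one function $w_{\mathfrak{gl}}$ satisfying relations 1–4, and it has the following property. If $\alpha$ is an involution without fixed points (that is, a chord diagram), then the Schur substitution applied to $w_{\mathfrak{gl}}(\alpha)$ contains no monomial in the variables $S_1,S_2,\dots$ (with coefficients in $\mathbb{C}[N]$) with an odd number, counted with multiplicity, of odd-indexed variables $S_k$. -/

import Mathlib

open scoped PowerSeries

/-- The coefficient ring `ℂ[N]`; the indeterminate `N` is `Polynomial.X`. -/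
abbrev CoeffRing : Type := Polynomial ℂ

/-- Polynomials over `ℂ[N]` in countably many variables indexed by `1, 2, 3, …`.
It serves both as `ℂ[N, C₁, C₂, …]` (Casimir variables) and as `ℂ[N, S₁, S₂, …]`
(variables for the one-part Schur polynomials). -/
abbrev VarRing : Type := MvPolynomial ℕ+ CoeffRing

/-- The element `N` of the polynomial ring. -/
noncomputable def varN : VarRing := MvPolynomial.C Polynomial.X

/-- The connected sum (concatenation) of `α ∈ 𝕊_m` and `β ∈ 𝕊_n`: `α` acts on the first `m` and
`β` on the last `n` of the `m + n` elements. -/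
def concatPerm {m n : ℕ} (α : Equiv.Perm (Fin m)) (β : Equiv.Perm (Fin n)) :
    Equiv.Perm (Fin (m + n)) :=
  finSumFinEquiv.permCongr (Equiv.Perm.sumCongr α β)

/-- Delete the element `p` from a permutation, joining the arrow that enters `p` with the arrow
that leaves `p` (a fixed point `p` just disappears), and renumber the remaining elements
preserving their order. -/
def deleteLeg {m : ℕ} (p : Fin (m + 1)) (α : Equiv.Perm (Fin (m + 1))) : Equiv.Perm (Fin m) :=
  Equiv.removeNone ((finSuccEquiv' p).permCongr α)

/-- The transposition of the neighbouring elements `k` and `k + 1`. -/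
def neighborSwap {m : ℕ} (k : Fin m) : Equiv.Perm (Fin (m + 1)) :=
  Equiv.swap k.castSucc k.succ

/-- The defining relations of the universal `𝔤𝔩`-weight system on permutations. A permutation `α`
is drawn as the directed graph with arrows `i → α i`. -/
structure IsGlWeightSystem (w : ∀ m : ℕ, Equiv.Perm (Fin m) → VarRing) : Prop where
  /-- The value on the empty diagram is `1`. -/
  empty : w 0 1 = 1
  /-- Multiplicativity with respect to concatenation. -/
  concat : ∀ (m n : ℕ) (α : Equiv.Perm (Fin m)) (β : Equiv.Perm (Fin n)),
    w (m + n) (concatPerm α β) = w m α * w n β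
  /-- The value on the standard cycle `1 → 2 → ⋯ → m → 1` is `C_m`. -/
  cycle : ∀ m : ℕ+, w m (finRotate m) = MvPolynomial.X m
  /-- The recurrence relation for neighbouring elements `k`, `k + 1` that are not joined by an
  arrow. If `a → k + 1 → b` and `d → k → c` in `α`, then on the left-hand side `α` is compared with
  the permutation in which `a → k → b` and `d → k + 1 → c`. On the right-hand side `k` and `k + 1`
  are replaced by a single element `•`: in the first term `d → • → b` and `a → c`, in the second
  term `a → • → c` and `d → b`. -/
  recurrence : ∀ (m : ℕ) (α : Equiv.Perm (Fin (m + 1))) (k : Fin m),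
    α k.succ ≠ k.castSucc → α k.castSucc ≠ k.succ →
    w (m + 1) α - w (m + 1) (neighborSwap k * α * neighborSwap k) =
      w m (deleteLeg k.succ (α * neighborSwap k)) -
        w m (deleteLeg k.castSucc (α * neighborSwap k))
  /-- The form of the recurrence relation for `a → k + 1 → k → b` (with `a ≠ k`): on the right-hand
  side there are `a → b`, both elements being removed, and `a → • → b`. -/
  recurrence_adjacent : ∀ (m : ℕ) (α : Equiv.Perm (Fin (m + 2))) (k : Fin (m + 1)),
    α k.succ = k.castSucc → α k.castSucc ≠ k.succ →
    w (m + 2) α - w (m + 2) (neighborSwap k * α * neighborSwap k) =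
      MvPolynomial.X 1 * w m (deleteLeg k (deleteLeg k.succ α)) -
        varN * w (m + 1) (deleteLeg k.succ α)

/-- The series `1 + ∑_{i ≥ 1} S_i u^i`. -/
noncomputable def schurSeries : VarRing⟦X⟧ :=
  PowerSeries.mk fun i => if h : 0 < i then MvPolynomial.X ⟨i, h⟩ else 1

/-- The power series `1 / (1 - c u) = 1 + c u + c² u² + ⋯`. -/
noncomputable def geomSeries (c : VarRing) : VarRing⟦X⟧ :=
  PowerSeries.mk fun i => c ^ i

/-- `(N - 1) / 2`. -/
noncomputable def halfNSubOne : VarRing :=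
  MvPolynomial.C (Polynomial.C (1 / 2 : ℂ) * (Polynomial.X - 1))

/-- `(N + 1) / 2`. -/
noncomputable def halfNAddOne : VarRing :=
  MvPolynomial.C (Polynomial.C (1 / 2 : ℂ) * (Polynomial.X + 1))

/-- The formal power `f ^ N = ∑_j binom(N, j) (f - 1)^j` of a power series `f` with constant
term `1`, the exponent being the indeterminate `N`. -/
noncomputable def powN (f : VarRing⟦X⟧) : VarRing⟦X⟧ :=
  (PowerSeries.binomialSeries VarRing (Polynomial.X : CoeffRing)).subst (f - 1)

/-- The right-hand side of the generating series identity
`1 - N u - ∑_{k ≥ 1} C_k u^{k+1} = ((1 - (N+1)u/2) / (1 - (N-1)u/2))^N *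
  (1 + ∑_{i ≥ 1} S_i (u / (1 - (N-1)u/2))^i) / (1 + ∑_{i ≥ 1} S_i (u / (1 - (N+1)u/2))^i)`. -/
noncomputable def casimirSeries : VarRing⟦X⟧ :=
  powN ((1 - PowerSeries.C halfNAddOne * PowerSeries.X) * geomSeries halfNSubOne) *
    schurSeries.subst (PowerSeries.X * geomSeries halfNSubOne) *
    PowerSeries.invOfUnit (schurSeries.subst (PowerSeries.X * geomSeries halfNAddOne)) 1

/-- The polynomial in `N, S₁, S₂, …` by which `C_k` is replaced: minus the coefficient of
`u^{k+1}` in `casimirSeries`. -/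
noncomputable def casimirInSchur (k : ℕ+) : VarRing :=
  -PowerSeries.coeff ((k : ℕ) + 1) casimirSeries

/-- The Schur substitution `ℂ[N, C₁, C₂, …] → ℂ[N, S₁, S₂, …]`. -/
noncomputable def schurSubstitution : VarRing →ₐ[CoeffRing] VarRing :=
  MvPolynomial.aeval casimirInSchur

/-- The number of odd-indexed variables in a monomial, counted with multiplicity. -/
def oddIndexedDegree (d : ℕ+ →₀ ℕ) : ℕ :=
  d.sum fun k e => if Odd (k : ℕ) then e else 0

/-! Uniqueness. Modulo shorter permutations, relations 3 and 4 allow conjugation by any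
transposition of neighbours, hence by any permutation. A transitive permutation is conjugate to the
standard cycle, any other one to a concatenation of two shorter ones, so all values are determined
(`perm_induction`, `IsGlSystem.unique`). The same reduction yields a polynomial `universalValue`
that represents the value of every solution in every commutative ℂ-algebra.

Existence. If a matrix `E` satisfies the commutation relations of 𝔤𝔩_n, the sums `glSum E` solve the
relations with `N = n` and `C_k = tr E^k` (`IsGlMatrix.isGlSystem`). For the differential operators
`glOperator n`, the leading symbol of `tr E^k` is the power trace `tr X^k` of a generic matrix, and
for large `n` such traces are algebraically independent up to any given index. So a polynomial in
`N, C_1, C_2, …` vanishing under these realisations for all `n` is zero, and the universal values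
inherit the relations (`isGlSystem_universal`).

Symmetry. If `w` is a solution, so is `α ↦ (-1)^m w(α⁻¹)`, with the same `N` but other values on the
standard cycles (`IsGlSystem.inverse`). Let `Φ(u) = 1 - N u - ∑ C_k u^{k+1}` and let `D(u)` be the
generating series of the values on inverse cycles. Reordering the factors of `tr E^m` gives `(1 + u
D(u)) Φ(u / (1 + N u)) = 1`. In the Schur variables, the shift by `-N` exchanges numerator and
denominator of `Φ` up to `u ↦ -u`, `S_k ↦ (-1)^k S_k` (`parityRescale_casimirSeries_mul`). Hence the
new cycle values are the old ones after `S_k ↦ (-1)^k S_k`, and by uniqueness inversion of `α` acts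
on all values by this involution and the sign `(-1)^m`. For a chord diagram `α⁻¹ = α` and `m` is
even, so monomials of odd parity cancel. -/

/-! ### Combinatorics of permutations -/

theorem succAbove_deleteLeg {m : ℕ} (p : Fin (m + 1)) (α : Equiv.Perm (Fin (m + 1))) (x : Fin m) :
    p.succAbove (deleteLeg p α x) =
      if α (p.succAbove x) = p then α p else α (p.succAbove x) := by
  set e := (finSuccEquiv' p).permCongr α with he
  have h1 : e (some x) = finSuccEquiv' p (α (p.succAbove x)) := by
    simp [he, Equiv.permCongr_apply]
  have h0 : e none = finSuccEquiv' p (α p) := by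
    simp [he, Equiv.permCongr_apply]
  have key : ∀ y : Fin m, ∀ z, some y = finSuccEquiv' p z → p.succAbove y = z := by
    intro y z h
    rw [← finSuccEquiv'_symm_some, h, Equiv.symm_apply_apply]
  change p.succAbove (Equiv.removeNone e x) = _
  split_ifs with h
  · apply key
    rw [← h0]
    apply Equiv.removeNone_none
    rw [h1, h, finSuccEquiv'_at]
  · apply key
    rw [← h1]
    apply Equiv.removeNone_some
    rw [← Option.ne_none_iff_exists', h1, Ne, finSuccEquiv'_eq_none]
    exact fun h' => h h'.symm

theorem eq_deleteLeg_iff {m : ℕ} (p : Fin (m + 1)) (α : Equiv.Perm (Fin (m + 1)))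
    (β : Equiv.Perm (Fin m)) :
    β = deleteLeg p α ↔
      ∀ x, p.succAbove (β x) = if α (p.succAbove x) = p then α p else α (p.succAbove x) := by
  constructor
  · rintro rfl x
    exact succAbove_deleteLeg p α x
  · intro h
    ext1 x
    apply Fin.succAbove_right_injective (p := p)
    rw [h, succAbove_deleteLeg]

theorem deleteLeg_inv {m : ℕ} (p : Fin (m + 1)) (α : Equiv.Perm (Fin (m + 1))) :
    deleteLeg p α⁻¹ = (deleteLeg p α)⁻¹ := by
  change Equiv.removeNone _ = (Equiv.removeNone _).symm
  rw [Equiv.removeNone_symm]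
  rfl

theorem concatPerm_inv {m n : ℕ} (α : Equiv.Perm (Fin m)) (β : Equiv.Perm (Fin n)) :
    (concatPerm α β)⁻¹ = concatPerm α⁻¹ β⁻¹ := by
  ext x : 1
  rfl

theorem concatPerm_castAdd {m n : ℕ} (α : Equiv.Perm (Fin m)) (β : Equiv.Perm (Fin n))
    (x : Fin m) : concatPerm α β (Fin.castAdd n x) = Fin.castAdd n (α x) := by
  simp [concatPerm, Equiv.permCongr_apply]

theorem concatPerm_natAdd {m n : ℕ} (α : Equiv.Perm (Fin m)) (β : Equiv.Perm (Fin n))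
    (x : Fin n) : concatPerm α β (Fin.natAdd m x) = Fin.natAdd m (β x) := by
  simp [concatPerm, Equiv.permCongr_apply]

theorem neighborSwap_castSucc {m : ℕ} (k : Fin m) : neighborSwap k k.castSucc = k.succ :=
  Equiv.swap_apply_left _ _

theorem neighborSwap_succ {m : ℕ} (k : Fin m) : neighborSwap k k.succ = k.castSucc :=
  Equiv.swap_apply_right _ _

theorem neighborSwap_of_ne {m : ℕ} {k : Fin m} {x : Fin (m + 1)} (h : x ≠ k.castSucc)
    (h' : x ≠ k.succ) : neighborSwap k x = x :=
  Equiv.swap_apply_of_ne_of_ne h h'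

theorem neighborSwap_inv {m : ℕ} (k : Fin m) : (neighborSwap k)⁻¹ = neighborSwap k :=
  Equiv.swap_inv _ _

theorem neighborSwap_mul_self {m : ℕ} (k : Fin m) : neighborSwap k * neighborSwap k = 1 :=
  Equiv.swap_mul_self _ _

theorem neighborSwap_conj_conj {m : ℕ} (k : Fin m) (α : Equiv.Perm (Fin (m + 1))) :
    neighborSwap k * (neighborSwap k * α * neighborSwap k) * neighborSwap k = α := by
  have h := neighborSwap_mul_self k
  calc _ = (neighborSwap k * neighborSwap k) * α * (neighborSwap k * neighborSwap k) := by group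
    _ = α := by rw [h]; simp

/-- The one configuration covered by neither recurrence: exchanging the neighbours has no effect
there. -/
theorem neighborSwap_conj_of_exchange {m : ℕ} (k : Fin m) (α : Equiv.Perm (Fin (m + 1)))
    (h : α k.succ = k.castSucc) (h' : α k.castSucc = k.succ) :
    neighborSwap k * α * neighborSwap k = α := by
  have hc : neighborSwap k * α = α * neighborSwap k := by
    have := Equiv.swap_apply_apply α k.castSucc k.succ
    rw [h, h', Equiv.swap_comm] at this
    change neighborSwap k = α * neighborSwap k * α⁻¹ at this
    nth_rewrite 1 [this]
    group
  rw [hc, mul_assoc, neighborSwap_mul_self, mul_one]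

/-- A permutation which is not transitive is, up to renumbering, a concatenation of two shorter
permutations. -/
theorem exists_concatPerm_of_not_transitive {m : ℕ} (α : Equiv.Perm (Fin m)) (x₀ y₀ : Fin m)
    (h : ¬ α.SameCycle x₀ y₀) :
    ∃ (a b : ℕ) (g : Fin (a + b) ≃ Fin m) (α₁ : Equiv.Perm (Fin a)) (α₂ : Equiv.Perm (Fin b)),
      0 < a ∧ 0 < b ∧ α = g.permCongr (concatPerm α₁ α₂) := by
  classical
  let p : Fin m → Prop := α.SameCycle x₀
  let e₁ : Fin (Fintype.card {x // p x}) ≃ {x // p x} := (Fintype.equivFin _).symm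
  let e₂ : Fin (Fintype.card {x // ¬ p x}) ≃ {x // ¬ p x} := (Fintype.equivFin _).symm
  have hp : ∀ x, p (α x) ↔ p x := fun x => Equiv.Perm.sameCycle_apply_right
  refine ⟨_, _, finSumFinEquiv.symm.trans ((Equiv.sumCongr e₁ e₂).trans (Equiv.sumCompl p)),
    e₁.symm.permCongr (α.subtypePerm hp),
    e₂.symm.permCongr (α.subtypePerm fun x => not_congr (hp x)), ?_, ?_, ?_⟩
  · exact Fintype.card_pos_iff.2 ⟨⟨x₀, Equiv.Perm.SameCycle.refl _ _⟩⟩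
  · exact Fintype.card_pos_iff.2 ⟨⟨y₀, h⟩⟩
  · ext1 x
    by_cases hx : p x
    · simp [Equiv.permCongr_apply, concatPerm, Equiv.sumCompl_symm_apply_of_pos hx]
    · simp [Equiv.permCongr_apply, concatPerm, Equiv.sumCompl_symm_apply_of_neg hx]

theorem isConj_finRotate_of_transitive {m : ℕ} (α : Equiv.Perm (Fin m))
    (h : ∀ x y, α.SameCycle x y) : IsConj (finRotate m) α := by
  rcases m with _ | _ | m
  · rw [Subsingleton.elim α (finRotate 0)]
  · have : Subsingleton (Fin (0 + 1)) := inferInstanceAs (Subsingleton (Fin 1))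
    rw [Subsingleton.elim α (finRotate (0 + 1))]
  · rw [Equiv.Perm.isConj_iff_cycleType_eq, cycleType_finRotate]
    have hne : ∀ x, α x ≠ x := by
      intro x hx
      obtain ⟨y, hy⟩ := exists_ne x
      obtain ⟨i, hi⟩ := h x y
      rw [Equiv.Perm.zpow_apply_eq_self_of_apply_eq_self hx] at hi
      exact hy hi.symm
    have hc : α.IsCycle := ⟨0, hne 0, fun y _ => h 0 y⟩
    have hs : α.support = Finset.univ := by
      ext x; simp [hne x]
    rw [hc.cycleType, hs]
    simp

/-- Induction principle for properties of permutations: all permutations are reached from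
concatenations of standard cycles by exchanging neighbours, up to shorter permutations. -/
theorem perm_induction {Q : ∀ m : ℕ, Equiv.Perm (Fin m) → Prop}
    (h_empty : Q 0 1)
    (h_concat : ∀ m n α β, Q m α → Q n β → Q (m + n) (concatPerm α β))
    (h_cycle : ∀ m : ℕ+, Q m (finRotate m))
    (h_rec : ∀ (m : ℕ) (α : Equiv.Perm (Fin (m + 1))) (k : Fin m),
      (∀ β, Q m β) → α k.succ ≠ k.castSucc → α k.castSucc ≠ k.succ →
        Q (m + 1) (neighborSwap k * α * neighborSwap k) → Q (m + 1) α)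
    (h_adj : ∀ (m : ℕ) (α : Equiv.Perm (Fin (m + 2))) (k : Fin (m + 1)),
      (∀ β, Q m β) → (∀ β, Q (m + 1) β) → α k.succ = k.castSucc → α k.castSucc ≠ k.succ →
        (Q (m + 2) (neighborSwap k * α * neighborSwap k) ↔ Q (m + 2) α)) :
    ∀ m α, Q m α := by
  intro m
  induction m using Nat.strong_induction_on with
  | _ m ih =>
  rcases m with _ | m
  · intro α
    rwa [Subsingleton.elim α 1]
  have step : ∀ (k : Fin m) (α : Equiv.Perm (Fin (m + 1))),
      Q (m + 1) (neighborSwap k * α * neighborSwap k) → Q (m + 1) α := by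
    intro k α hα
    obtain ⟨m, rfl⟩ : ∃ n, m = n + 1 := ⟨m - 1, by have := k.isLt; omega⟩
    have i1 := ih (m + 1) (by omega)
    have i0 := ih m (by omega)
    by_cases h1 : α k.succ = k.castSucc <;> by_cases h2 : α k.castSucc = k.succ
    · rwa [neighborSwap_conj_of_exchange k α h1 h2] at hα
    · exact (h_adj m α k i0 i1 h1 h2).1 hα
    -- For an arrow `k → k + 1` the adjacent relation applies only to the conjugate of `α`, and is
    -- read backwards; this is why `h_adj` is an equivalence.
    · have := h_adj m (neighborSwap k * α * neighborSwap k) k i0 i1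
        (by simp [neighborSwap_succ, h2]) ?_
      · rw [neighborSwap_conj_conj] at this
        exact this.2 hα
      · simp only [Equiv.Perm.coe_mul, Function.comp_apply, neighborSwap_castSucc]
        intro h
        apply h1
        apply (neighborSwap k).injective
        rwa [neighborSwap_castSucc]
    · exact h_rec (m + 1) α k i1 h1 h2 hα
  have conj : ∀ g : Equiv.Perm (Fin (m + 1)), ∀ α, Q (m + 1) (g * α * g⁻¹) → Q (m + 1) α := by
    intro g
    have hg : g ∈ Submonoid.closure
        (Set.range fun i : Fin m => Equiv.swap i.castSucc i.succ) := by
      rw [Equiv.Perm.mclosure_swap_castSucc_succ]; trivial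
    induction hg using Submonoid.closure_induction with
    | mem x hx =>
      obtain ⟨i, rfl⟩ := hx
      intro α hα
      apply step i α
      rwa [Equiv.swap_inv] at hα
    | one => intro α hα; simpa using hα
    | mul x y _ _ hx hy =>
      intro α hα
      apply hy
      apply hx
      convert hα using 1
      group
  intro α
  by_cases h : ∀ x y, α.SameCycle x y
  · obtain ⟨g, hg⟩ := isConj_iff.1 (isConj_finRotate_of_transitive α h)
    apply conj g⁻¹
    rw [← hg]
    have hr : g⁻¹ * (g * finRotate (m + 1) * g⁻¹) * g⁻¹⁻¹ = finRotate (m + 1) := by group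
    rw [hr]
    exact h_cycle ⟨m + 1, by omega⟩
  · push Not at h
    obtain ⟨x, y, hxy⟩ := h
    obtain ⟨a, b, g, α₁, α₂, ha, hb, hα⟩ := exists_concatPerm_of_not_transitive α x y hxy
    have hab : a + b = m + 1 := Fin.equiv_iff_eq.1 ⟨g⟩
    have hQ := h_concat a b α₁ α₂ (ih a (by omega) α₁) (ih b (by omega) α₂)
    clear hxy x y step
    revert α
    -- The length has to be a variable before it can be replaced by `a + b`.
    generalize m + 1 = n at hab conj g
    subst hab
    intro α hα
    apply conj g⁻¹
    convert hQ using 1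
    rw [hα]
    ext1 x
    simp

/-! ### Solutions of the defining relations in an arbitrary ring -/

/-- The relations of the `𝔤𝔩`-weight system for functions with values in a ring `R`, with `N` and
the values on standard cycles specialised to given elements of `R`. -/
structure IsGlSystem {R : Type*} [Ring R] (N : R) (c : ℕ+ → R)
    (w : ∀ m : ℕ, Equiv.Perm (Fin m) → R) : Prop where
  empty : w 0 1 = 1
  concat : ∀ (m n : ℕ) (α : Equiv.Perm (Fin m)) (β : Equiv.Perm (Fin n)),
    w (m + n) (concatPerm α β) = w m α * w n β
  cycle : ∀ m : ℕ+, w m (finRotate m) = c m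
  recurrence : ∀ (m : ℕ) (α : Equiv.Perm (Fin (m + 1))) (k : Fin m),
    α k.succ ≠ k.castSucc → α k.castSucc ≠ k.succ →
    w (m + 1) α - w (m + 1) (neighborSwap k * α * neighborSwap k) =
      w m (deleteLeg k.succ (α * neighborSwap k)) -
        w m (deleteLeg k.castSucc (α * neighborSwap k))
  recurrence_adjacent : ∀ (m : ℕ) (α : Equiv.Perm (Fin (m + 2))) (k : Fin (m + 1)),
    α k.succ = k.castSucc → α k.castSucc ≠ k.succ →
    w (m + 2) α - w (m + 2) (neighborSwap k * α * neighborSwap k) =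
      c 1 * w m (deleteLeg k (deleteLeg k.succ α)) - N * w (m + 1) (deleteLeg k.succ α)

theorem isGlWeightSystem_iff (w : ∀ m : ℕ, Equiv.Perm (Fin m) → VarRing) :
    IsGlWeightSystem w ↔ IsGlSystem varN MvPolynomial.X w :=
  ⟨fun h => ⟨h.empty, h.concat, h.cycle, h.recurrence, h.recurrence_adjacent⟩,
    fun h => ⟨h.empty, h.concat, h.cycle, h.recurrence, h.recurrence_adjacent⟩⟩

namespace IsGlSystem

variable {R : Type*} [Ring R] {N : R} {c : ℕ+ → R} {w : ∀ m : ℕ, Equiv.Perm (Fin m) → R}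

theorem map {S : Type*} [Ring S] (h : IsGlSystem N c w) (f : R →+* S) :
    IsGlSystem (f N) (fun k => f (c k)) fun m α => f (w m α) where
  empty := by rw [h.empty, map_one]
  concat m n α β := by rw [h.concat, map_mul]
  cycle m := by rw [h.cycle]
  recurrence m α k h1 h2 := by rw [← map_sub, h.recurrence m α k h1 h2, map_sub]
  recurrence_adjacent m α k h1 h2 := by
    rw [← map_sub, h.recurrence_adjacent m α k h1 h2, map_sub, map_mul, map_mul]

/-- Relations pulled back along an injective homomorphism. -/
theorem of_injective {S : Type*} [Ring S] {N : S} {c : ℕ+ → S}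
    {w : ∀ m : ℕ, Equiv.Perm (Fin m) → S} (f : S →+* R) (hf : Function.Injective f)
    (h : IsGlSystem (f N) (fun k => f (c k)) fun m α => f (w m α)) : IsGlSystem N c w where
  empty := hf (by rw [h.empty, map_one])
  concat m n α β := hf (by rw [h.concat, map_mul])
  cycle m := hf (by rw [h.cycle])
  recurrence m α k h1 h2 := hf (by rw [map_sub, h.recurrence m α k h1 h2, map_sub])
  recurrence_adjacent m α k h1 h2 := hf (by
    rw [map_sub, h.recurrence_adjacent m α k h1 h2, map_sub, map_mul, map_mul])

theorem unique {w' : ∀ m : ℕ, Equiv.Perm (Fin m) → R} (h : IsGlSystem N c w)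
    (h' : IsGlSystem N c w') : w = w' := by
  suffices ∀ m α, w m α = w' m α by ext m α; exact this m α
  apply perm_induction
  · rw [h.empty, h'.empty]
  · intro m n α β hα hβ
    rw [h.concat, h'.concat, hα, hβ]
  · intro m
    rw [h.cycle, h'.cycle]
  · intro m α k hm h1 h2 hα
    have e := h.recurrence m α k h1 h2
    rw [hm, hm, ← h'.recurrence m α k h1 h2, hα] at e
    exact sub_left_injective e
  · intro m α k h0 h1 ha hb
    have e := h.recurrence_adjacent m α k ha hb
    rw [h0, h1, ← h'.recurrence_adjacent m α k ha hb] at e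
    constructor
    · intro hα
      rw [hα] at e
      exact sub_left_injective e
    · intro hα
      rw [hα] at e
      exact sub_right_injective e

/-- Needed for noncommutative `R`: it confines the sums `glSum E` to the algebra generated by the
traces of powers of `E`. -/
theorem mem_subring (h : IsGlSystem N c w) (S : Subring R) (hN : N ∈ S) (hc : ∀ k, c k ∈ S) :
    ∀ m α, w m α ∈ S := by
  apply perm_induction
  · rw [h.empty]; exact one_mem S
  · intro m n α β hα hβ
    rw [h.concat]; exact mul_mem hα hβ
  · intro m
    rw [h.cycle]; exact hc m
  · intro m α k hm h1 h2 hα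
    rw [sub_eq_iff_eq_add.1 (h.recurrence m α k h1 h2)]
    exact add_mem (sub_mem (hm _) (hm _)) hα
  · intro m α k h0 h1 ha hb
    have e := h.recurrence_adjacent m α k ha hb
    have hr := sub_mem (mul_mem (hc 1) (h0 (deleteLeg k (deleteLeg k.succ α))))
      (mul_mem hN (h1 (deleteLeg k.succ α)))
    rw [← e] at hr
    exact ⟨fun hα => (sub_mem_comm_iff.1 hr |> fun h' => by simpa using sub_mem hα h'),
      fun hα => by simpa using sub_mem hα hr⟩

end IsGlSystem

/-- The specialisation of `ℂ[N, C₁, C₂, …]` at given values of the variables. -/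
noncomputable def glEval {R : Type*} [CommRing R] [Algebra ℂ R] (N : R) (c : ℕ+ → R) :
    VarRing →+* R :=
  MvPolynomial.eval₂Hom (Polynomial.aeval N).toRingHom c

theorem glEval_X {R : Type*} [CommRing R] [Algebra ℂ R] (N : R) (c : ℕ+ → R) (k : ℕ+) :
    glEval N c (MvPolynomial.X k) = c k := by
  simp [glEval]

theorem glEval_varN {R : Type*} [CommRing R] [Algebra ℂ R] (N : R) (c : ℕ+ → R) :
    glEval N c varN = N := by
  simp [glEval, varN]

/-- The reduction of `perm_induction` is carried out symbolically. No consistency is claimed here: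
`P` may depend on the reduction chosen, and it is pinned down only once enough solutions are known.
-/
theorem exists_universal_polynomial (m : ℕ) (α : Equiv.Perm (Fin m)) :
    ∃ P : VarRing, ∀ (R : Type) [CommRing R] [Algebra ℂ R] (N : R) (c : ℕ+ → R)
      (w : ∀ m : ℕ, Equiv.Perm (Fin m) → R), IsGlSystem N c w → w m α = glEval N c P := by
  revert m
  apply perm_induction
  · exact ⟨1, fun R _ _ N c w h => by rw [h.empty, map_one]⟩
  · rintro m n α β ⟨P, hP⟩ ⟨P', hP'⟩
    exact ⟨P * P', fun R _ _ N c w h => by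
      rw [h.concat, map_mul, hP R N c w h, hP' R N c w h]⟩
  · intro m
    exact ⟨MvPolynomial.X m, fun R _ _ N c w h => by rw [h.cycle, glEval_X]⟩
  · rintro m α k hm h1 h2 ⟨P, hP⟩
    obtain ⟨P₁, hP₁⟩ := hm (deleteLeg k.succ (α * neighborSwap k))
    obtain ⟨P₂, hP₂⟩ := hm (deleteLeg k.castSucc (α * neighborSwap k))
    refine ⟨P₁ - P₂ + P, fun R _ _ N c w h => ?_⟩
    rw [sub_eq_iff_eq_add.1 (h.recurrence m α k h1 h2), hP R N c w h, hP₁ R N c w h,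
      hP₂ R N c w h, map_add, map_sub]
  · intro m α k h0 h1 ha hb
    obtain ⟨P₁, hP₁⟩ := h0 (deleteLeg k (deleteLeg k.succ α))
    obtain ⟨P₂, hP₂⟩ := h1 (deleteLeg k.succ α)
    constructor
    · rintro ⟨P, hP⟩
      refine ⟨MvPolynomial.X 1 * P₁ - varN * P₂ + P, fun R _ _ N c w h => ?_⟩
      rw [sub_eq_iff_eq_add.1 (h.recurrence_adjacent m α k ha hb), hP R N c w h, hP₁ R N c w h,
        hP₂ R N c w h, map_add, map_sub, map_mul, map_mul, glEval_X, glEval_varN]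
    · rintro ⟨P, hP⟩
      refine ⟨P - (MvPolynomial.X 1 * P₁ - varN * P₂), fun R _ _ N c w h => ?_⟩
      rw [map_sub, map_sub, map_mul, map_mul, glEval_X, glEval_varN, ← hP R N c w h,
        ← hP₁ R N c w h, ← hP₂ R N c w h, ← h.recurrence_adjacent m α k ha hb, sub_sub_cancel]

/-- A polynomial representing the value at `α` of every solution of the relations. -/
noncomputable def universalValue (m : ℕ) (α : Equiv.Perm (Fin m)) : VarRing :=
  (exists_universal_polynomial m α).choose

theorem glEval_universalValue {R : Type} [CommRing R] [Algebra ℂ R] {N : R} {c : ℕ+ → R}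
    {w : ∀ m : ℕ, Equiv.Perm (Fin m) → R} (h : IsGlSystem N c w) (m : ℕ)
    (α : Equiv.Perm (Fin m)) : glEval N c (universalValue m α) = w m α :=
  ((exists_universal_polynomial m α).choose_spec R N c w h).symm

/-! ### Ordered products -/

section OrderedProducts

variable {A : Type*} [Ring A]

theorem prod_ofFn_of_commute {m : ℕ} (k : Fin (m + 1)) (f : Fin (m + 1) → A)
    (h : ∀ l, Commute (f k) (f l)) :
    (List.ofFn f).prod = f k * (List.ofFn fun l => f (k.succAbove l)).prod := by
  induction m with
  | zero => obtain rfl : k = 0 := Fin.fin_one_eq_zero k; simp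
  | succ m ih =>
    rw [List.ofFn_succ, List.prod_cons]
    cases k using Fin.cases with
    | zero => simp
    | succ k =>
      rw [ih k (fun l => f l.succ) fun l => h _, List.ofFn_succ (f := fun l => f (k.succ.succAbove l)),
        List.prod_cons]
      simp only [Fin.succ_succAbove_zero, Fin.succ_succAbove_succ]
      rw [← mul_assoc, ← mul_assoc, (h 0).eq]

/-- Two neighbouring factors are merged into one slot, so that a commutator of neighbours becomes a
single argument of a multilinear map. -/
theorem prod_ofFn_eq_prod_update {m : ℕ} (k : Fin m) (f : Fin (m + 1) → A) :
    (List.ofFn f).prod = (List.ofFn (Function.update (fun l => f (k.succ.succAbove l)) k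
      (f k.castSucc * f k.succ))).prod := by
  induction m with
  | zero => exact k.elim0
  | succ m ih =>
    rw [List.ofFn_succ, List.prod_cons]
    cases k using Fin.cases with
    | zero =>
      rw [List.ofFn_succ, List.prod_cons, List.ofFn_succ, List.prod_cons, ← mul_assoc]
      congr 1
    | succ k =>
      rw [ih k (fun l => f l.succ), List.ofFn_succ (n := m), List.prod_cons]
      congr 2
      congr 1
      funext l
      by_cases hl : l = k
      · subst hl; simp
      · have : l.succ ≠ k.succ := fun h => hl (Fin.succ_injective _ h)
        simp [Function.update_of_ne hl, Function.update_of_ne this, Fin.succ_succAbove_succ]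

theorem neighborSwap_succAbove {m : ℕ} {k l : Fin m} (h : l ≠ k) :
    neighborSwap k (k.succ.succAbove l) = k.succ.succAbove l := by
  apply neighborSwap_of_ne _ (Fin.succAbove_ne _ _)
  rw [← Fin.succAbove_succ_self k]
  exact fun h' => h (Fin.succAbove_right_injective h')

theorem castSucc_succAbove_of_ne {m : ℕ} {k l : Fin m} (h : l ≠ k) :
    k.castSucc.succAbove l = k.succ.succAbove l := by
  rcases lt_or_gt_of_ne h with h | h
  · rw [Fin.succAbove_of_castSucc_lt _ _ (by simpa using h),
      Fin.succAbove_of_castSucc_lt _ _ (by rw [Fin.lt_def] at *; simp; omega)]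
  · rw [Fin.succAbove_of_le_castSucc _ _ (by rw [Fin.le_def]; rw [Fin.lt_def] at h; simp; omega),
      Fin.succAbove_of_le_castSucc _ _ (by rw [Fin.le_def]; rw [Fin.lt_def] at h; simp; omega)]

theorem prod_ofFn_sub_swap {m : ℕ} (k : Fin m) (f : Fin (m + 1) → A) :
    (List.ofFn f).prod - (List.ofFn fun l => f (neighborSwap k l)).prod =
      (List.ofFn (Function.update (fun l => f (k.succ.succAbove l)) k
        (f k.castSucc * f k.succ - f k.succ * f k.castSucc))).prod := by
  have h := (MultilinearMap.mkPiAlgebraFin ℤ m A).map_update_sub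
    (fun l => f (k.succ.succAbove l)) k (f k.castSucc * f k.succ) (f k.succ * f k.castSucc)
  simp only [MultilinearMap.mkPiAlgebraFin_apply] at h
  rw [h, prod_ofFn_eq_prod_update k f, prod_ofFn_eq_prod_update k fun l => f (neighborSwap k l)]
  congr 3
  funext l
  by_cases hl : l = k
  · subst hl; simp [neighborSwap_succ, neighborSwap_castSucc]
  · simp [Function.update_of_ne hl, neighborSwap_succAbove hl]

theorem prod_ofFn_update_sub {m : ℕ} (k : Fin m) (f : Fin m → A) (x y : A) :
    (List.ofFn (Function.update f k (x - y))).prod =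
      (List.ofFn (Function.update f k x)).prod - (List.ofFn (Function.update f k y)).prod := by
  simpa only [MultilinearMap.mkPiAlgebraFin_apply] using
    (MultilinearMap.mkPiAlgebraFin ℤ m A).map_update_sub f k x y

theorem prod_ofFn_update_ite {m : ℕ} (k : Fin m) (f : Fin m → A) (x : A) (p : Prop)
    [Decidable p] :
    (List.ofFn (Function.update f k (if p then x else 0))).prod =
      if p then (List.ofFn (Function.update f k x)).prod else 0 := by
  split_ifs
  · rfl
  · simpa only [MultilinearMap.mkPiAlgebraFin_apply] using
      (MultilinearMap.mkPiAlgebraFin ℤ m A).map_update_zero f k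

theorem prod_ofFn_update_sum {ι : Type*} [Fintype ι] {m : ℕ} (k : Fin m) (f : Fin m → A)
    (x : ι → A) :
    (List.ofFn (Function.update f k (∑ a, x a))).prod =
      ∑ a, (List.ofFn (Function.update f k (x a))).prod := by
  simpa only [MultilinearMap.mkPiAlgebraFin_apply] using
    (MultilinearMap.mkPiAlgebraFin ℤ m A).map_update_sum Finset.univ k x f

end OrderedProducts

/-! ### Matrices of generators of `𝔤𝔩` -/

/-- The commutation relations of the matrix units generating `𝔤𝔩`. -/
def IsGlMatrix {ι A : Type*} [DecidableEq ι] [Ring A] (E : Matrix ι ι A) : Prop :=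
  ∀ i j k l, E i j * E k l - E k l * E i j =
    (if j = k then E i l else 0) - (if i = l then E k j else 0)

/-- The element `∑_i E_{i₁ i_{α(1)}} ⋯ E_{i_m i_{α(m)}}`. -/
def glSum {ι A : Type*} [Fintype ι] [Ring A] (E : Matrix ι ι A) (m : ℕ)
    (α : Equiv.Perm (Fin m)) : A :=
  ∑ i : Fin m → ι, (List.ofFn fun l => E (i l) (i (α l))).prod

section GlSum

variable {ι A : Type*} [Fintype ι] [Ring A] (E : Matrix ι ι A)

theorem sum_insertNth {M : Type*} [AddCommMonoid M] {m : ℕ} (p : Fin (m + 1))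
    (F : (Fin (m + 1) → ι) → M) :
    ∑ i, F i = ∑ x, ∑ j : Fin m → ι, F (p.insertNth x j) := by
  rw [← Fintype.sum_prod_type']
  exact (Fintype.sum_equiv (Fin.insertNthEquiv (fun _ => ι) p) _ _ fun _ => rfl).symm

/-- The Kronecker delta eliminates the index at `p`; replacing it by the index at `β p` in the
factor whose arrow enters `p` joins that arrow with the one leaving `p`. -/
theorem glSum_deleteLeg [DecidableEq ι] {m : ℕ} (p : Fin (m + 1)) (β : Equiv.Perm (Fin (m + 1)))
    (hp : β p ≠ p) :
    glSum E m (deleteLeg p β) = ∑ i : Fin (m + 1) → ι, if i p = i (β p) then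
      (List.ofFn fun l => E (i (p.succAbove l)) (i (β (p.succAbove l)))).prod else 0 := by
  obtain ⟨q, hq⟩ := Fin.exists_succAbove_eq hp
  rw [sum_insertNth p, Finset.sum_comm, glSum]
  apply Finset.sum_congr rfl
  intro j _
  rw [← hq]
  simp only [Fin.insertNth_apply_same, Fin.insertNth_apply_succAbove, Finset.sum_ite_eq',
    Finset.mem_univ, if_true]
  congr 2
  funext l
  congr 1
  have h := succAbove_deleteLeg p β l
  split_ifs at h with h'
  · rw [h', Fin.insertNth_apply_same]
    rw [← hq] at h
    rw [Fin.succAbove_right_injective h]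
  · rw [← h, Fin.insertNth_apply_succAbove]

/-- With the factor at the fixed point `p` omitted, the index at `p` is free; its summation is the
source of the factor `N` in relation 4. -/
theorem glSum_deleteLeg_of_fixed {m : ℕ} (p : Fin (m + 1)) (β : Equiv.Perm (Fin (m + 1)))
    (hp : β p = p) :
    ∑ i : Fin (m + 1) → ι, (List.ofFn fun l => E (i (p.succAbove l)) (i (β (p.succAbove l)))).prod
      = (Fintype.card ι : A) * glSum E m (deleteLeg p β) := by
  rw [sum_insertNth p]
  have h : ∀ l, β (p.succAbove l) = p.succAbove (deleteLeg p β l) := by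
    intro l
    rw [succAbove_deleteLeg, if_neg]
    intro h
    exact Fin.succAbove_ne p l (β.injective (h.trans hp.symm))
  simp [h, Fin.insertNth_apply_succAbove, glSum, nsmul_eq_mul]

/-- After renaming the summation indices, conjugation by the transposition only exchanges two
neighbouring factors, so the difference contains their commutator. -/
theorem glSum_sub_conj {m : ℕ} (α : Equiv.Perm (Fin (m + 1))) (k : Fin m) :
    glSum E (m + 1) α - glSum E (m + 1) (neighborSwap k * α * neighborSwap k) =
      ∑ i : Fin (m + 1) → ι, (List.ofFn (Function.update
        (fun l => E (i (k.succ.succAbove l)) (i (α (k.succ.succAbove l)))) k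
        (E (i k.castSucc) (i (α k.castSucc)) * E (i k.succ) (i (α k.succ)) -
          E (i k.succ) (i (α k.succ)) * E (i k.castSucc) (i (α k.castSucc))))).prod := by
  have h : glSum E (m + 1) (neighborSwap k * α * neighborSwap k) =
      ∑ i : Fin (m + 1) → ι,
        (List.ofFn fun l => E (i (neighborSwap k l)) (i (α (neighborSwap k l)))).prod := by
    refine (Fintype.sum_equiv ((neighborSwap k).arrowCongr (Equiv.refl ι)) _ _ fun i => ?_).symm
    congr 2
    funext l
    have hs : (neighborSwap k).symm = neighborSwap k := neighborSwap_inv k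
    have hss : ∀ x, neighborSwap k (neighborSwap k x) = x := fun x =>
      DFunLike.congr_fun (neighborSwap_mul_self k) x
    simp [Equiv.arrowCongr_apply, hs, hss]
  rw [h, glSum, ← Finset.sum_sub_distrib]
  exact Finset.sum_congr rfl fun i _ => prod_ofFn_sub_swap k fun l => E (i l) (i (α l))

variable {E}

/-- Each of the two deltas in the commutator eliminates one index, at `k + 1` and at `k`
respectively. -/
theorem glSum_recurrence [DecidableEq ι] (hE : IsGlMatrix E) (m : ℕ)
    (α : Equiv.Perm (Fin (m + 1))) (k : Fin m) (h1 : α k.succ ≠ k.castSucc)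
    (h2 : α k.castSucc ≠ k.succ) :
    glSum E (m + 1) α - glSum E (m + 1) (neighborSwap k * α * neighborSwap k) =
      glSum E m (deleteLeg k.succ (α * neighborSwap k)) -
        glSum E m (deleteLeg k.castSucc (α * neighborSwap k)) := by
  rw [glSum_sub_conj, glSum_deleteLeg E _ _ (by simpa [neighborSwap_succ] using h2),
    glSum_deleteLeg E _ _ (by simpa [neighborSwap_castSucc] using h1), ← Finset.sum_sub_distrib]
  apply Finset.sum_congr rfl
  intro i _
  rw [hE, prod_ofFn_update_sub, prod_ofFn_update_ite, prod_ofFn_update_ite]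
  simp only [Equiv.Perm.coe_mul, Function.comp_apply, neighborSwap_succ, neighborSwap_castSucc]
  congr 1
  · simp only [eq_comm (a := i k.succ)]
    congr 3
    funext l
    by_cases hl : l = k
    · subst hl; simp [neighborSwap_castSucc]
    · simp [Function.update_of_ne hl, neighborSwap_succAbove hl]
  · congr 3
    funext l
    by_cases hl : l = k
    · subst hl; simp [neighborSwap_succ]
    · simp [Function.update_of_ne hl, castSucc_succAbove_of_ne hl, neighborSwap_succAbove hl]

theorem IsGlMatrix.commute_trace [DecidableEq ι] (hE : IsGlMatrix E) (i j : ι) :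
    Commute (∑ x, E x x) (E i j) := by
  rw [commute_iff_eq, ← sub_eq_zero, Finset.sum_mul, Finset.mul_sum, ← Finset.sum_sub_distrib]
  simp [hE _ _ _ _, Finset.sum_sub_distrib]

/-- Both sides contract the arrow `k + 1 → k`: on the left `k` has become a fixed point, and `k + 1`
has taken over its outgoing arrow. -/
theorem deleteLeg_mul_neighborSwap {m : ℕ} (α : Equiv.Perm (Fin (m + 1))) (k : Fin m)
    (h1 : α k.succ = k.castSucc) :
    deleteLeg k.castSucc (α * neighborSwap k) = deleteLeg k.succ α := by
  have hfix : ∀ l, (α * neighborSwap k) (k.castSucc.succAbove l) ≠ k.castSucc := by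
    intro l hl
    have : (α * neighborSwap k) k.castSucc = k.castSucc := by simp [neighborSwap_castSucc, h1]
    exact Fin.succAbove_ne _ _ ((α * neighborSwap k).injective (hl.trans this.symm))
  rw [eq_deleteLeg_iff]
  intro x
  have h := succAbove_deleteLeg k.castSucc (α * neighborSwap k) x
  rw [if_neg (hfix x)] at h
  set y := deleteLeg k.castSucc (α * neighborSwap k) x
  have hx : (α * neighborSwap k) (k.castSucc.succAbove x) = α (k.succ.succAbove x) := by
    by_cases hx : x = k
    · subst hx; simp [neighborSwap_succ]
    · simp [castSucc_succAbove_of_ne hx, neighborSwap_succAbove hx]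
  rw [hx] at h
  rw [← h, h1]
  by_cases hy : y = k
  · rw [hy]; simp
  · rw [if_neg, castSucc_succAbove_of_ne hy]
    rw [castSucc_succAbove_of_ne hy]
    exact Fin.succAbove_ne _ _

theorem glSum_recurrence_adjacent [DecidableEq ι] (hE : IsGlMatrix E) (m : ℕ)
    (α : Equiv.Perm (Fin (m + 2))) (k : Fin (m + 1)) (h1 : α k.succ = k.castSucc)
    (h2 : α k.castSucc ≠ k.succ) :
    glSum E (m + 2) α - glSum E (m + 2) (neighborSwap k * α * neighborSwap k) =
      (∑ x, E x x) * glSum E m (deleteLeg k (deleteLeg k.succ α)) -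
        (Fintype.card ι : A) * glSum E (m + 1) (deleteLeg k.succ α) := by
  have hfix : (α * neighborSwap k) k.castSucc = k.castSucc := by simp [neighborSwap_castSucc, h1]
  rw [← deleteLeg_mul_neighborSwap α k h1, ← glSum_deleteLeg_of_fixed E _ _ hfix]
  set γ := deleteLeg k.castSucc (α * neighborSwap k) with hγ
  have hγ' : ∀ l, k.castSucc.succAbove (γ l) = α (k.succ.succAbove l) := by
    intro l
    rw [hγ, succAbove_deleteLeg, if_neg]
    · by_cases hl : l = k
      · subst hl; simp [neighborSwap_succ]
      · simp [castSucc_succAbove_of_ne hl, neighborSwap_succAbove hl]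
    · intro hl
      exact Fin.succAbove_ne _ _ ((α * neighborSwap k).injective (hl.trans hfix.symm))
  have hγk : k.castSucc.succAbove (γ k) = α k.castSucc := by rw [hγ']; simp
  have hne : γ k ≠ k := by
    intro h
    rw [h, Fin.succAbove_castSucc_self] at hγk
    exact h2 hγk.symm
  rw [glSum_sub_conj, glSum_deleteLeg E _ _ hne]
  simp_rw [hE _ _ _ _, prod_ofFn_update_sub, prod_ofFn_update_ite, h1, if_true]
  rw [Finset.sum_sub_distrib]
  congr 1
  -- First delta: the index at `k` now occurs only in the factor `E x x`. Summing over it gives the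
  -- central element `tr E`, which moves to the front.
  · rw [sum_insertNth k.castSucc, Finset.sum_comm, Finset.mul_sum]
    apply Finset.sum_congr rfl
    intro j _
    have e1 : ∀ x, (k.castSucc.insertNth x j : Fin (m + 2) → ι) k.succ = j k := by
      intro x
      conv_lhs => rw [← Fin.succAbove_castSucc_self]
      rw [Fin.insertNth_apply_succAbove]
    have e2 : ∀ x, (k.castSucc.insertNth x j : Fin (m + 2) → ι) (α k.castSucc) = j (γ k) := by
      intro x
      rw [← hγk, Fin.insertNth_apply_succAbove]
    have e3 : ∀ x, Function.update (fun l => E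
        ((k.castSucc.insertNth x j : Fin (m + 2) → ι) (k.succ.succAbove l))
        ((k.castSucc.insertNth x j : Fin (m + 2) → ι) (α (k.succ.succAbove l)))) k (E x x) =
        Function.update (fun l => E (j l) (j (γ l))) k (E x x) := by
      intro x
      funext l
      by_cases hl : l = k
      · subst hl; simp
      · rw [Function.update_of_ne hl, Function.update_of_ne hl, ← hγ',
          ← castSucc_succAbove_of_ne hl, Fin.insertNth_apply_succAbove,
          Fin.insertNth_apply_succAbove]
    simp only [e1, e2, e3, Fin.insertNth_apply_same]
    simp only [mul_ite, mul_zero, eq_comm (a := j k)]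
    split_ifs
    · rw [← prod_ofFn_update_sum, prod_ofFn_of_commute k]
      · simp
      · intro l
        by_cases hl : l = k
        · subst hl; exact Commute.refl _
        · simpa [Function.update_of_ne hl] using hE.commute_trace _ _
    · simp
  -- Second delta: since `α (k + 1) = k`, its condition is trivially true, and the index at `k`
  -- stays free.
  · apply Finset.sum_congr rfl
    intro i _
    congr 2
    funext l
    by_cases hl : l = k
    · subst hl; simp [neighborSwap_succ]
    · simp [Function.update_of_ne hl, castSucc_succAbove_of_ne hl, neighborSwap_succAbove hl]

theorem glSum_concatPerm (m n : ℕ) (α : Equiv.Perm (Fin m)) (β : Equiv.Perm (Fin n)) :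
    glSum E (m + n) (concatPerm α β) = glSum E m α * glSum E n β := by
  rw [glSum, glSum, glSum, Fintype.sum_mul_sum, ← Fintype.sum_prod_type']
  refine (Fintype.sum_equiv (Fin.appendEquiv m n) _ _ fun x => ?_).symm
  obtain ⟨i, j⟩ := x
  rw [← List.prod_append, ← List.ofFn_fin_append]
  congr 2
  funext l
  cases l using Fin.addCases with
  | left l => simp [concatPerm_castAdd]
  | right l => simp [concatPerm_natAdd]

theorem matrix_pow_apply_eq_sum [DecidableEq ι] (E : Matrix ι ι A) (m : ℕ) (a b : ι) :
    (E ^ (m + 1)) a b = ∑ i : Fin m → ι, (List.ofFn fun l : Fin (m + 1) =>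
      E (Fin.cons (α := fun _ => ι) a i l) (Fin.snoc (α := fun _ => ι) i b l)).prod := by
  induction m generalizing a with
  | zero => simp [Fin.snoc]
  | succ m ih =>
    rw [pow_succ', Matrix.mul_apply]
    rw [← Fintype.sum_equiv (Fin.consEquiv fun _ => ι) (fun x => _) _ fun _ => rfl,
      Fintype.sum_prod_type]
    apply Finset.sum_congr rfl
    intro x _
    rw [ih, Finset.mul_sum]
    apply Finset.sum_congr rfl
    intro i _
    rw [List.ofFn_succ (n := m + 1), List.prod_cons]
    simp [Fin.consEquiv, ← Fin.cons_snoc_eq_snoc_cons]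

theorem glSum_finRotate [DecidableEq ι] (E : Matrix ι ι A) (m : ℕ) :
    glSum E (m + 1) (finRotate (m + 1)) = (E ^ (m + 1)).trace := by
  simp only [Matrix.trace, Matrix.diag, matrix_pow_apply_eq_sum]
  rw [glSum, ← Fintype.sum_equiv (Fin.consEquiv fun _ => ι) (fun x => _) _ fun _ => rfl,
      Fintype.sum_prod_type]
  simp [Fin.consEquiv, Fin.snoc_eq_cons_rotate]

theorem IsGlMatrix.isGlSystem [DecidableEq ι] (hE : IsGlMatrix E) :
    IsGlSystem (Fintype.card ι : A) (fun k => (E ^ (k : ℕ)).trace) (glSum E) where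
  empty := by simp [glSum]
  concat := glSum_concatPerm
  cycle m := by
    obtain ⟨n, hn⟩ : ∃ n, (m : ℕ) = n + 1 := ⟨m - 1, by have := m.pos; omega⟩
    rw [hn, glSum_finRotate]
  recurrence := glSum_recurrence hE
  recurrence_adjacent m α k h1 h2 := by
    rw [glSum_recurrence_adjacent hE m α k h1 h2]
    simp [Matrix.trace]

end GlSum

/-! ### Central traces and the inverse standard cycle -/

section Covariance

variable {ι A : Type*} [DecidableEq ι] [Ring A] {E : Matrix ι ι A}

/-- The commutation relations of a matrix `F` with `E` saying that the entries of `F` transform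
under `𝔤𝔩` like those of `E`. -/
def IsGlCovariant (E F : Matrix ι ι A) : Prop :=
  ∀ i j p q, E i j * F p q - F p q * E i j =
    (if j = p then F i q else 0) - (if i = q then F p j else 0)

theorem isGlCovariant_one : IsGlCovariant E 1 := by
  intro i j p q
  simp only [Matrix.one_apply, mul_ite, ite_mul, mul_one, one_mul, mul_zero, zero_mul, sub_self]
  by_cases h1 : j = p <;> by_cases h2 : i = q <;> simp [h1, h2, eq_comm]

variable [Fintype ι]

/-- The two terms of the covariance relation cancel when summed over `p = q`. -/
theorem IsGlCovariant.commute_trace {F : Matrix ι ι A} (hF : IsGlCovariant E F) (i j : ι) :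
    Commute (E i j) F.trace := by
  rw [commute_iff_eq, ← sub_eq_zero, Matrix.trace, Finset.sum_mul, Finset.mul_sum,
    ← Finset.sum_sub_distrib]
  simp [Matrix.diag, hF _ _ _ _, Finset.sum_sub_distrib]

/-- By the Leibniz rule; the two contributions of the inner summation index cancel. -/
theorem IsGlCovariant.mul {F G : Matrix ι ι A} (hF : IsGlCovariant E F)
    (hG : IsGlCovariant E G) : IsGlCovariant E (F * G) := by
  intro i j p q
  have h : ∀ a, E i j * (F p a * G a q) - F p a * G a q * E i j =
      (if j = p then F i a * G a q else 0) - (if i = a then F p j * G a q else 0) +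
        ((if j = a then F p a * G i q else 0) - (if i = q then F p a * G a j else 0)) := by
    intro a
    have e1 := congrArg (· * G a q) (hF i j p a)
    have e2 := congrArg (F p a * ·) (hG i j a q)
    simp only [sub_mul, mul_sub, ite_mul, mul_ite, zero_mul, mul_zero] at e1 e2
    rw [← e1, ← e2]
    noncomm_ring
  rw [Matrix.mul_apply, Finset.mul_sum, Finset.sum_mul, ← Finset.sum_sub_distrib]
  simp_rw [h]
  rw [Finset.sum_add_distrib, Finset.sum_sub_distrib, Finset.sum_sub_distrib]
  simp only [Finset.sum_ite_eq, Finset.mem_univ, if_true]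
  by_cases h1 : j = p <;> by_cases h2 : i = q <;> simp [h1, h2, Matrix.mul_apply] <;> abel

theorem IsGlMatrix.covariant_pow (hE : IsGlMatrix E) (m : ℕ) : IsGlCovariant E (E ^ m) := by
  induction m with
  | zero => rw [pow_zero]; exact isGlCovariant_one
  | succ m ih => rw [pow_succ]; exact ih.mul hE

/-- The powers of `E` with the factors of each product written in the opposite order. -/
def oppositePow (E : Matrix ι ι A) (m : ℕ) : Matrix ι ι A :=
  Matrix.of fun i j => MulOpposite.unop (((E.map MulOpposite.op) ^ m) i j)

theorem oppositePow_zero : oppositePow E 0 = 1 := by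
  ext i j
  by_cases h : i = j <;> simp [oppositePow, Matrix.one_apply, h]

theorem oppositePow_succ_apply (m : ℕ) (i j : ι) :
    oppositePow E (m + 1) i j = ∑ a, oppositePow E m a j * E i a := by
  simp [oppositePow, pow_succ', Matrix.mul_apply]

theorem IsGlMatrix.covariant_oppositePow (hE : IsGlMatrix E) (m : ℕ) :
    IsGlCovariant E (oppositePow E m) := by
  induction m with
  | zero => rw [oppositePow_zero]; exact isGlCovariant_one
  | succ m ih =>
    intro i j p q
    have h : ∀ a, E i j * (oppositePow E m a q * E p a) - oppositePow E m a q * E p a * E i j =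
        (if j = a then oppositePow E m i q * E p a else 0) -
          (if i = q then oppositePow E m a j * E p a else 0) +
        ((if j = p then oppositePow E m a q * E i a else 0) -
          (if i = a then oppositePow E m a q * E p j else 0)) := by
      intro a
      have e1 := congrArg (· * E p a) (ih i j a q)
      have e2 := congrArg (oppositePow E m a q * ·) (hE i j p a)
      simp only [sub_mul, mul_sub, ite_mul, mul_ite, zero_mul, mul_zero] at e1 e2
      rw [← e1, ← e2]
      noncomm_ring
    simp only [oppositePow_succ_apply]
    rw [Finset.mul_sum, Finset.sum_mul, ← Finset.sum_sub_distrib]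
    simp_rw [h]
    rw [Finset.sum_add_distrib, Finset.sum_sub_distrib, Finset.sum_sub_distrib]
    simp only [Finset.sum_ite_eq, Finset.mem_univ, if_true]
    by_cases h1 : j = p <;> by_cases h2 : i = q <;> simp [h1, h2] <;> abel

/-- Write `F` for `oppositePow E m`. Moving `E i a` to the left of `F a j` costs the commutator `F i
j - δ_{ij} F a a`; summed over `a` this produces the shift of `E` by `N` and the scalar matrix `tr
F`. -/
theorem IsGlMatrix.oppositePow_succ (hE : IsGlMatrix E) (m : ℕ) :
    oppositePow E (m + 1) = (E - (Fintype.card ι : Matrix ι ι A)) * oppositePow E m +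
      Matrix.diagonal fun _ => (oppositePow E m).trace := by
  ext i j
  rw [oppositePow_succ_apply, sub_mul, ← nsmul_eq_mul, Matrix.add_apply, Matrix.sub_apply,
    Matrix.mul_apply, Matrix.smul_apply]
  have h : ∀ a, oppositePow E m a j * E i a = E i a * oppositePow E m a j -
      ((oppositePow E m i j) - (if i = j then oppositePow E m a a else 0)) := by
    intro a
    have := hE.covariant_oppositePow m i a a j
    rw [if_pos rfl] at this
    rw [← this, sub_sub_cancel]
  simp_rw [h]
  rw [Finset.sum_sub_distrib, Finset.sum_sub_distrib]
  by_cases hij : i = j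
  · subst hij; simp [Matrix.trace]; abel
  · simp [hij]

theorem IsGlMatrix.oppositePow_eq (hE : IsGlMatrix E) (m : ℕ) :
    oppositePow E m = (E - (Fintype.card ι : Matrix ι ι A)) ^ m +
      ∑ j ∈ Finset.range m, (E - (Fintype.card ι : Matrix ι ι A)) ^ j *
        Matrix.diagonal fun _ => (oppositePow E (m - 1 - j)).trace := by
  induction m with
  | zero => simp [oppositePow_zero]
  | succ m ih =>
    rw [hE.oppositePow_succ, Finset.sum_range_succ', pow_zero, one_mul, ← add_assoc]
    congr 1
    rw [ih, mul_add, ← pow_succ', Finset.mul_sum]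
    congr 1
    apply Finset.sum_congr rfl
    intro j hj
    rw [← mul_assoc, ← pow_succ']
    rw [show m - 1 - j = m + 1 - 1 - (j + 1) by omega]

theorem trace_mul_diagonal (F : Matrix ι ι A) (d : A) :
    (F * Matrix.diagonal fun _ => d).trace = F.trace * d := by
  simp [Matrix.trace, Finset.sum_mul]

/-- For the generating series `D` of the left-hand traces and `T` of `tr (E - N)^m` this reads `D =
T + u T D`. -/
theorem IsGlMatrix.trace_oppositePow (hE : IsGlMatrix E) (m : ℕ) :
    (oppositePow E m).trace = ((E - (Fintype.card ι : Matrix ι ι A)) ^ m).trace +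
      ∑ j ∈ Finset.range m, ((E - (Fintype.card ι : Matrix ι ι A)) ^ j).trace *
        (oppositePow E (m - 1 - j)).trace := by
  conv_lhs => rw [hE.oppositePow_eq]
  rw [Matrix.trace_add, Matrix.trace_sum]
  simp_rw [trace_mul_diagonal]

theorem trace_sub_natCast_pow (E : Matrix ι ι A) (n m : ℕ) :
    ((E - (n : Matrix ι ι A)) ^ m).trace =
      ∑ k ∈ Finset.range (m + 1), (E ^ k).trace * (-(n : A)) ^ (m - k) * (m.choose k : A) := by
  have hc : Commute E (-(n : Matrix ι ι A)) := (Nat.cast_commute n E).symm.neg_right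
  rw [sub_eq_add_neg, hc.add_pow, Matrix.trace_sum]
  apply Finset.sum_congr rfl
  intro k _
  have h1 : ∀ r : ℕ, (-(n : Matrix ι ι A)) ^ r = Matrix.diagonal fun _ => (-(n : A)) ^ r := by
    intro r
    have h : -(n : Matrix ι ι A) = Matrix.diagonal fun _ => -(n : A) := by
      rw [← Matrix.diagonal_natCast, Matrix.diagonal_neg]
    rw [h, Matrix.diagonal_pow]
    rfl
  rw [h1, ← Matrix.diagonal_natCast, trace_mul_diagonal, trace_mul_diagonal]

theorem unop_prod_ofFn {n : ℕ} (f : Fin n → Aᵐᵒᵖ) :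
    MulOpposite.unop (List.ofFn f).prod =
      (List.ofFn fun l => MulOpposite.unop (f (Fin.rev l))).prod := by
  rw [MulOpposite.unop_list_prod]
  congr 1
  apply List.ext_getElem
  · simp
  · intro i h1 h2
    simp only [List.getElem_reverse, List.getElem_map, List.getElem_ofFn]
    congr 2
    ext
    simp [Fin.val_rev]
    omega

/-- Reversing the order of the indices turns the inverse cycle into the standard one, with the
factors multiplied in the opposite order. -/
theorem glSum_finRotate_inv (E : Matrix ι ι A) (m : ℕ) :
    glSum E (m + 1) (finRotate (m + 1))⁻¹ = (oppositePow E (m + 1)).trace := by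
  have hrot : ∀ l : Fin (m + 1), Fin.rev ((finRotate (m + 1))⁻¹ l) =
      finRotate (m + 1) (Fin.rev l) := by
    intro l
    obtain ⟨x, rfl⟩ := (finRotate (m + 1)).surjective l
    rw [Equiv.Perm.inv_def, Equiv.symm_apply_apply]
    by_cases hx : x = Fin.last m
    · subst hx; simp
    · have h1 := coe_finRotate_of_ne_last hx
      have hx' := Fin.val_lt_last hx
      have h2 : Fin.rev (finRotate (m + 1) x) ≠ Fin.last m := by
        intro h
        have := congrArg Fin.val h
        rw [Fin.val_rev, h1, Fin.val_last] at this
        omega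
      ext
      rw [coe_finRotate_of_ne_last h2, Fin.val_rev, Fin.val_rev, h1]
      omega
  have key : (oppositePow E (m + 1)).trace =
      MulOpposite.unop ((E.map MulOpposite.op) ^ (m + 1)).trace := by
    simp [oppositePow, Matrix.trace]
  rw [key, ← glSum_finRotate, glSum, glSum, Finset.unop_sum]
  refine Fintype.sum_equiv (Fin.revPerm.arrowCongr (Equiv.refl ι)) _ _ fun i => ?_
  rw [unop_prod_ofFn]
  congr 2
  funext l
  simp [Equiv.arrowCongr_apply, ← hrot]

end Covariance

/-! ### Power sums take arbitrary values -/

theorem sum_pow_mul_primitiveRoot {n : ℕ} {ζ : ℂ} (hζ : IsPrimitiveRoot ζ n) (x : ℂ) {j : ℕ}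
    (hj : 0 < j) (hjn : j < n) : ∑ i : Fin n, (x * ζ ^ (i : ℕ)) ^ j = 0 := by
  have hne : ζ ^ j ≠ 1 := hζ.pow_ne_one_of_pos_of_lt hj.ne' hjn
  have h : ∑ i : Fin n, (ζ ^ j) ^ (i : ℕ) = 0 := by
    rw [Fin.sum_univ_eq_sum_range (fun i => (ζ ^ j) ^ i) n]
    have := mul_geom_sum (ζ ^ j) n
    rw [← pow_mul, mul_comm j, pow_mul, hζ.pow_eq_one, one_pow, sub_self] at this
    exact (mul_eq_zero.1 this).resolve_left (sub_ne_zero.2 hne)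
  simp_rw [mul_pow, ← Finset.mul_sum, ← pow_mul, mul_comm _ j, pow_mul, h, mul_zero]

/-- Adjoining the `K + 1` points `x ζ^i`, with `ζ` a primitive root of unity of order `K + 1`,
leaves the power sums of index at most `K` unchanged and adds `(K + 1) x^{K+1}` to the next one. -/
theorem exists_power_sums_eq (K : ℕ) :
    ∃ n₀ : ℕ, ∀ n ≥ n₀, ∀ y : ℕ → ℂ, ∃ a : Fin n → ℂ,
      ∀ j, 0 < j → j ≤ K → ∑ i, a i ^ j = y j := by
  induction K with
  | zero => exact ⟨0, fun n _ y => ⟨0, fun j h h' => by omega⟩⟩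
  | succ K ih =>
    obtain ⟨n₀, h₀⟩ := ih
    refine ⟨n₀ + (K + 1), fun n hn y => ?_⟩
    obtain ⟨n', rfl⟩ : ∃ n', n = n' + (K + 1) := ⟨n - (K + 1), by omega⟩
    obtain ⟨a, ha⟩ := h₀ n' (by omega) y
    obtain ⟨x, hx⟩ := IsAlgClosed.exists_pow_nat_eq
      ((y (K + 1) - ∑ i, a i ^ (K + 1)) / ((K + 1 : ℕ) : ℂ)) (Nat.succ_pos K)
    have hζ := Complex.isPrimitiveRoot_exp (K + 1) (by omega)
    set ζ := Complex.exp (2 * Real.pi * Complex.I / ((K + 1 : ℕ) : ℂ))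
    refine ⟨Fin.append a fun i => x * ζ ^ (i : ℕ), fun j hj hjK => ?_⟩
    rw [Fin.sum_univ_add]
    simp only [Fin.append_left, Fin.append_right]
    rcases hjK.lt_or_eq with h | rfl
    · rw [sum_pow_mul_primitiveRoot hζ x hj h, ha j hj (by omega), add_zero]
    · have h : ∀ i : Fin (K + 1), (x * ζ ^ (i : ℕ)) ^ (K + 1) = x ^ (K + 1) := by
        intro i
        rw [mul_pow, ← pow_mul, mul_comm (i : ℕ), pow_mul, hζ.pow_eq_one, one_pow, mul_one]
      simp_rw [h, hx]
      rw [Finset.sum_const, Finset.card_univ, Fintype.card_fin, nsmul_eq_mul, mul_div_cancel₀]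
      · ring
      · exact_mod_cast Nat.succ_ne_zero K

/-! ### A faithful family of matrices of generators -/

section DifferentialOperators

variable (n : ℕ)

/-- The polynomial functions on `n × n` matrices. -/
abbrev MatrixPoly : Type := MvPolynomial (Fin n × Fin n) ℂ

variable {n}

/-- The derivation sending the entry `X_{kl}` to `X_{il}` if `k = j`, and to `0` otherwise. -/
noncomputable def rowDerivation (i j : Fin n) : Derivation ℂ (MatrixPoly n) (MatrixPoly n) :=
  MvPolynomial.mkDerivation ℂ fun p => if j = p.1 then MvPolynomial.X (i, p.2) else 0

theorem rowDerivation_X (i j k l : Fin n) :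
    rowDerivation i j (MvPolynomial.X (k, l)) = if j = k then MvPolynomial.X (i, l) else 0 := by
  simp [rowDerivation, MvPolynomial.mkDerivation_X]

theorem rowDerivation_lie (i j k l : Fin n) :
    ⁅rowDerivation i j, rowDerivation k l⁆ =
      (if j = k then rowDerivation i l else 0) - (if i = l then rowDerivation k j else 0) := by
  apply MvPolynomial.derivation_ext
  rintro ⟨r, s⟩
  rw [Derivation.commutator_apply, rowDerivation_X, rowDerivation_X, Derivation.sub_apply]
  have h1 : ∀ (p : Prop) [Decidable p] (D : Derivation ℂ (MatrixPoly n) (MatrixPoly n)) f,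
      (if p then D else 0) f = if p then D f else 0 := by
    intro p _ D f; split_ifs <;> rfl
  have h2 : ∀ (p : Prop) [Decidable p] (D : Derivation ℂ (MatrixPoly n) (MatrixPoly n)) f,
      D (if p then f else 0) = if p then D f else 0 := by
    intro p _ D f; split_ifs <;> simp
  rw [h1, h1, h2, h2, rowDerivation_X, rowDerivation_X, rowDerivation_X, rowDerivation_X]
  by_cases a : l = r <;> by_cases b : j = r <;> by_cases c : j = k <;> by_cases d : i = l <;>
    simp_all [eq_comm]

/-- A realisation of `𝔤𝔩_n` by differential operators of the form "multiplication by a matrix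
entry plus a derivation preserving the degree". -/
noncomputable def glOperator (n : ℕ) :
    Matrix (Fin n) (Fin n) (Module.End ℂ (MatrixPoly n)) :=
  Matrix.of fun i j => LinearMap.mulLeft ℂ (MvPolynomial.X (i, j)) + (rowDerivation i j : _ →ₗ[ℂ] _)

theorem glOperator_apply (i j : Fin n) (f : MatrixPoly n) :
    glOperator n i j f = MvPolynomial.X (i, j) * f + rowDerivation i j f := rfl

/-- Multiplications commute among themselves, and `rowDerivation` acts on the coordinates `X (k, l)`
by the same formula as on matrix units. Adding the multiplication thus preserves the relations,
while it gives the operator the symbol `X (i, j)`. -/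
theorem isGlMatrix_glOperator (n : ℕ) : IsGlMatrix (glOperator n) := by
  intro i j k l
  apply LinearMap.ext
  intro f
  have h := DFunLike.congr_fun (rowDerivation_lie i j k l) f
  rw [Derivation.commutator_apply] at h
  have h1 : ∀ (p : Prop) [Decidable p] (T : Module.End ℂ (MatrixPoly n)),
      (if p then T else 0) f = if p then T f else 0 := by
    intro p _ T; split_ifs <;> rfl
  have h2 : ∀ (p : Prop) [Decidable p] (D : Derivation ℂ (MatrixPoly n) (MatrixPoly n)),
      (if p then D else 0) f = if p then D f else 0 := by
    intro p _ D; split_ifs <;> rfl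
  rw [Derivation.sub_apply, h2, h2] at h
  rw [LinearMap.sub_apply, LinearMap.sub_apply, h1, h1, Module.End.mul_apply,
    Module.End.mul_apply]
  simp only [glOperator_apply, map_add, Derivation.leibniz, rowDerivation_X, smul_eq_mul]
  have e : (if l = i then MvPolynomial.X (k, j) else 0 : MatrixPoly n) =
      if i = l then MvPolynomial.X (k, j) else 0 := if_congr eq_comm rfl rfl
  rw [e]
  split_ifs at h ⊢ <;> linear_combination h

end DifferentialOperators

/-! ### Leading symbols of operators on polynomials -/

section Symbols

variable {σ : Type*}

/-- The polynomials of total degree less than `d`. -/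
noncomputable def degreeBelow (σ : Type*) (d : ℕ) : Submodule ℂ (MvPolynomial σ ℂ) :=
  MvPolynomial.restrictSupport ℂ {m | m.degree < d}

theorem mem_degreeBelow {d : ℕ} {f : MvPolynomial σ ℂ} :
    f ∈ degreeBelow σ d ↔ ∀ m ∈ f.support, m.degree < d := Iff.rfl

theorem degreeBelow_mono {d e : ℕ} (h : d ≤ e) : degreeBelow σ d ≤ degreeBelow σ e :=
  fun _ hf m hm => (mem_degreeBelow.1 hf m hm).trans_le h

theorem mul_mem_degreeBelow {d e : ℕ} {f g : MvPolynomial σ ℂ} (hf : f ∈ degreeBelow σ (d + 1))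
    (hg : g ∈ degreeBelow σ e) : f * g ∈ degreeBelow σ (d + e) := by
  classical
  rw [mem_degreeBelow] at *
  intro m hm
  obtain ⟨a, ha, b, hb, rfl⟩ := Finset.mem_add.1 (MvPolynomial.support_mul f g hm)
  have h1 := hf a ha
  have h2 := hg b hb
  rw [map_add]
  omega

theorem MvPolynomial.IsHomogeneous.mem_degreeBelow {d : ℕ} {f : MvPolynomial σ ℂ}
    (hf : f.IsHomogeneous d) : f ∈ degreeBelow σ (d + 1) := by
  rw [_root_.mem_degreeBelow]
  intro m hm
  rw [hf.degree_eq_sum_deg_support hm]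
  exact Nat.lt_succ_self _

/-- The operator `T` on polynomials differs from multiplication by `q` (of degree at most `d`) by
terms which raise the degree by less than `d`. -/
def HasLeadingSymbol (T : Module.End ℂ (MvPolynomial σ ℂ)) (d : ℕ) (q : MvPolynomial σ ℂ) : Prop :=
  q ∈ degreeBelow σ (d + 1) ∧
    ∀ e, ∀ f ∈ degreeBelow σ (e + 1), T f - q * f ∈ degreeBelow σ (d + e)

namespace HasLeadingSymbol

variable {T U : Module.End ℂ (MvPolynomial σ ℂ)} {d e : ℕ} {p q : MvPolynomial σ ℂ}

theorem apply_mem (h : HasLeadingSymbol T d q) {f : MvPolynomial σ ℂ}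
    (hf : f ∈ degreeBelow σ (e + 1)) : T f ∈ degreeBelow σ (d + e + 1) := by
  rw [← sub_add_cancel (T f) (q * f)]
  exact add_mem (degreeBelow_mono (Nat.le_succ _) (h.2 e f hf))
    (mul_mem_degreeBelow (e := e + 1) h.1 hf)

theorem one : HasLeadingSymbol (1 : Module.End ℂ (MvPolynomial σ ℂ)) 0 1 :=
  ⟨(MvPolynomial.isHomogeneous_one σ ℂ).mem_degreeBelow, fun e f _ => by simp⟩

theorem zero (d : ℕ) : HasLeadingSymbol (0 : Module.End ℂ (MvPolynomial σ ℂ)) d 0 :=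
  ⟨zero_mem _, fun e f _ => by simp⟩

theorem add (hT : HasLeadingSymbol T d p) (hU : HasLeadingSymbol U d q) :
    HasLeadingSymbol (T + U) d (p + q) := by
  refine ⟨add_mem hT.1 hU.1, fun e f hf => ?_⟩
  have := add_mem (hT.2 e f hf) (hU.2 e f hf)
  convert this using 1
  rw [LinearMap.add_apply]
  ring

theorem sum {ι : Type*} (s : Finset ι) {T : ι → Module.End ℂ (MvPolynomial σ ℂ)}
    {q : ι → MvPolynomial σ ℂ} (h : ∀ i ∈ s, HasLeadingSymbol (T i) d (q i)) :
    HasLeadingSymbol (∑ i ∈ s, T i) d (∑ i ∈ s, q i) := by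
  classical
  induction s using Finset.induction_on with
  | empty => simpa using zero d
  | insert a s ha ih =>
    rw [Finset.sum_insert ha, Finset.sum_insert ha]
    exact (h a (Finset.mem_insert_self a s)).add
      (ih fun i hi => h i (Finset.mem_insert_of_mem hi))

theorem smul (c : ℂ) (hT : HasLeadingSymbol T d p) : HasLeadingSymbol (c • T) d (c • p) := by
  refine ⟨Submodule.smul_mem _ c hT.1, fun e f hf => ?_⟩
  rw [LinearMap.smul_apply, smul_mul_assoc, ← smul_sub]
  exact Submodule.smul_mem _ c (hT.2 e f hf)

theorem mul (hT : HasLeadingSymbol T d p) (hU : HasLeadingSymbol U e q) :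
    HasLeadingSymbol (T * U) (d + e) (p * q) := by
  refine ⟨?_, fun r f hf => ?_⟩
  · rw [add_assoc]
    exact mul_mem_degreeBelow hT.1 hU.1
  -- Here `T U f - p q f = (T - p)(U f) + p (U f - q f)`.
  · have h1 := hT.2 _ _ (hU.apply_mem hf)
    have h2 := mul_mem_degreeBelow hT.1 (hU.2 r f hf)
    rw [← add_assoc] at h1 h2
    convert add_mem h1 h2 using 1
    rw [Module.End.mul_apply]
    ring

theorem pow (hT : HasLeadingSymbol T d p) (k : ℕ) : HasLeadingSymbol (T ^ k) (k * d) (p ^ k) := by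
  induction k with
  | zero => simpa using one
  | succ k ih =>
    rw [pow_succ, pow_succ, Nat.succ_mul]
    exact ih.mul hT

theorem of_lt (hT : HasLeadingSymbol T d p) (h : d < e) : HasLeadingSymbol T e 0 := by
  refine ⟨zero_mem _, fun r f hf => ?_⟩
  rw [zero_mul, sub_zero]
  exact degreeBelow_mono (by omega) (hT.apply_mem hf)

/-- Applied to the constant `1`, the definition says that `q` has degree less than `d`. -/
theorem eq_zero (h : HasLeadingSymbol (0 : Module.End ℂ (MvPolynomial σ ℂ)) d q)
    (hq : q.IsHomogeneous d) : q = 0 := by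
  have h1 := h.2 0 1 (MvPolynomial.isHomogeneous_one σ ℂ).mem_degreeBelow
  rw [LinearMap.zero_apply, zero_sub, mul_one, neg_mem_iff, mem_degreeBelow] at h1
  by_contra hne
  obtain ⟨m, hm⟩ := Finset.nonempty_of_ne_empty (mt MvPolynomial.support_eq_empty.1 hne)
  have h2 := h1 m hm
  rw [hq.degree_eq_sum_deg_support hm] at h2
  exact lt_irrefl _ h2

end HasLeadingSymbol

end Symbols

/-! ### Leading symbols of the traces of powers of `glOperator` -/

section GlOperatorSymbol

variable {n : ℕ}

theorem rowDerivation_mem_degreeBelow (i j : Fin n) (d : ℕ) (f : MatrixPoly n)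
    (hf : f ∈ degreeBelow _ d) : rowDerivation i j f ∈ degreeBelow _ d := by
  rw [f.as_sum, map_sum]
  apply Submodule.sum_mem
  intro m hm
  have hmd := mem_degreeBelow.1 hf m hm
  rw [rowDerivation, MvPolynomial.mkDerivation_monomial]
  apply Submodule.smul_mem
  apply Submodule.sum_mem
  intro p hp
  dsimp only
  rw [smul_eq_mul]
  split_ifs
  · have hle : Finsupp.single p 1 ≤ m := by
      rw [Finsupp.single_le_iff]
      exact Nat.one_le_iff_ne_zero.2 (Finsupp.mem_support_iff.1 hp)
    have hdeg : (m - Finsupp.single p 1).degree + 1 = m.degree := by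
      conv_rhs => rw [← tsub_add_cancel_of_le hle]
      simp [map_add, Finsupp.degree_single]
    have h1 := (MvPolynomial.isHomogeneous_monomial (m p : ℂ) rfl :
      (MvPolynomial.monomial (m - Finsupp.single p 1) (m p : ℂ)).IsHomogeneous _)
    have h2 := h1.mul (MvPolynomial.isHomogeneous_X ℂ (i, p.2))
    refine degreeBelow_mono ?_ h2.mem_degreeBelow
    omega
  · rw [mul_zero]
    exact zero_mem _

/-- The matrix of coordinate functions. -/
noncomputable def coordinateMatrix (n : ℕ) : Matrix (Fin n) (Fin n) (MatrixPoly n) :=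
  Matrix.of fun i j => MvPolynomial.X (i, j)

theorem hasLeadingSymbol_glOperator (i j : Fin n) :
    HasLeadingSymbol (glOperator n i j) 1 (coordinateMatrix n i j) := by
  refine ⟨(MvPolynomial.isHomogeneous_X ℂ (i, j)).mem_degreeBelow, fun e f hf => ?_⟩
  rw [glOperator_apply, coordinateMatrix, Matrix.of_apply, add_sub_cancel_left, add_comm]
  exact rowDerivation_mem_degreeBelow i j _ f hf

theorem hasLeadingSymbol_glOperator_pow (k : ℕ) (i j : Fin n) :
    HasLeadingSymbol ((glOperator n ^ k) i j) k ((coordinateMatrix n ^ k) i j) := by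
  induction k generalizing i j with
  | zero =>
    rw [pow_zero, pow_zero, Matrix.one_apply, Matrix.one_apply]
    split_ifs
    · exact HasLeadingSymbol.one
    · exact HasLeadingSymbol.zero 0
  | succ k ih =>
    rw [pow_succ, pow_succ, Matrix.mul_apply, Matrix.mul_apply]
    exact HasLeadingSymbol.sum _ fun a _ => (ih i a).mul (hasLeadingSymbol_glOperator a j)

theorem isHomogeneous_coordinateMatrix_pow (k : ℕ) (i j : Fin n) :
    ((coordinateMatrix n ^ k) i j).IsHomogeneous k := by
  induction k generalizing i j with
  | zero =>
    rw [pow_zero, Matrix.one_apply]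
    split_ifs
    · exact MvPolynomial.isHomogeneous_one _ _
    · exact MvPolynomial.isHomogeneous_zero _ _ _
  | succ k ih =>
    rw [pow_succ, Matrix.mul_apply]
    exact MvPolynomial.IsHomogeneous.sum _ _ _ fun a _ =>
      (ih i a).mul (MvPolynomial.isHomogeneous_X ℂ (a, j))

theorem hasLeadingSymbol_trace (k : ℕ) :
    HasLeadingSymbol (glOperator n ^ k).trace k (coordinateMatrix n ^ k).trace :=
  HasLeadingSymbol.sum _ fun i _ => hasLeadingSymbol_glOperator_pow k i i

theorem isHomogeneous_trace (k : ℕ) : (coordinateMatrix n ^ k).trace.IsHomogeneous k :=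
  MvPolynomial.IsHomogeneous.sum _ _ _ fun i _ => isHomogeneous_coordinateMatrix_pow k i i

end GlOperatorSymbol

/-- The weight of a monomial in the Casimir variables, `C_k` having weight `k`. -/
noncomputable def casimirWeight (m : ℕ+ →₀ ℕ) : ℕ :=
  Finsupp.weight (fun k : ℕ+ => (k : ℕ)) m

theorem casimirWeight_add (a b : ℕ+ →₀ ℕ) :
    casimirWeight (a + b) = casimirWeight a + casimirWeight b := map_add _ _ _

theorem casimirWeight_single (k : ℕ+) (e : ℕ) :
    casimirWeight (Finsupp.single k e) = e * k := by
  simp [casimirWeight, Finsupp.weight_single]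

/-! ### Polynomials in `N` and the Casimirs are separated by the operator realisations -/

section Separation

variable {n : ℕ}

/-- The substitution of the traces of powers of the coordinate matrix for the variables. -/
noncomputable def traceSubstitution (n : ℕ) : MvPolynomial ℕ+ ℂ →ₐ[ℂ] MatrixPoly n :=
  MvPolynomial.aeval fun k : ℕ+ => (coordinateMatrix n ^ (k : ℕ)).trace

theorem isHomogeneous_traceSubstitution (m : ℕ+ →₀ ℕ) :
    (traceSubstitution n (MvPolynomial.monomial m 1)).IsHomogeneous (casimirWeight m) := by
  induction m using Finsupp.induction_linear with
  | zero =>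
    rw [show (MvPolynomial.monomial 0 1 : MvPolynomial ℕ+ ℂ) = 1 from rfl, map_one]
    simpa [casimirWeight] using MvPolynomial.isHomogeneous_one _ _
  | add a b ha hb =>
    rw [← one_mul (1 : ℂ), ← MvPolynomial.monomial_mul, map_mul, casimirWeight_add]
    exact ha.mul hb
  | single k e =>
    rw [← MvPolynomial.X_pow_eq_monomial, map_pow, casimirWeight_single, mul_comm]
    simpa [traceSubstitution] using (isHomogeneous_trace (n := n) (k : ℕ)).pow e

theorem hasLeadingSymbol_monomial
    {Φ : VarRing →+* Module.End ℂ (MatrixPoly n)}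
    (hX : ∀ k, Φ (MvPolynomial.X k) = (glOperator n ^ (k : ℕ)).trace) (m : ℕ+ →₀ ℕ) :
    HasLeadingSymbol (Φ (MvPolynomial.monomial m 1)) (casimirWeight m)
      (traceSubstitution n (MvPolynomial.monomial m 1)) := by
  induction m using Finsupp.induction_linear with
  | zero =>
    rw [show (MvPolynomial.monomial 0 1 : MvPolynomial ℕ+ ℂ) = 1 from rfl,
      show (MvPolynomial.monomial 0 1 : VarRing) = 1 from rfl, map_one, map_one]
    simpa [casimirWeight] using HasLeadingSymbol.one
  | add a b ha hb =>
    rw [← one_mul (1 : ℂ), ← one_mul (1 : CoeffRing), ← MvPolynomial.monomial_mul,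
      ← MvPolynomial.monomial_mul, map_mul, map_mul, casimirWeight_add]
    exact ha.mul hb
  | single k e =>
    rw [← MvPolynomial.X_pow_eq_monomial, ← MvPolynomial.X_pow_eq_monomial, map_pow, map_pow,
      casimirWeight_single, hX]
    simpa [traceSubstitution] using (hasLeadingSymbol_trace (n := n) (k : ℕ)).pow e

/-- The specialisation of the coefficients at `N = n`. -/
noncomputable def specializeN (n : ℕ) : VarRing →+* MvPolynomial ℕ+ ℂ :=
  MvPolynomial.map (Polynomial.evalRingHom (n : ℂ))

/-- Monomials of weight below `d` have symbol zero in degree `d`, so the expression is the symbol of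
`Φ P = 0`; it is homogeneous of degree `d`. -/
theorem traceSubstitution_topComponent_eq_zero
    {Φ : VarRing →+* Module.End ℂ (MatrixPoly n)}
    (hX : ∀ k, Φ (MvPolynomial.X k) = (glOperator n ^ (k : ℕ)).trace)
    (hC : ∀ a : CoeffRing, Φ (MvPolynomial.C a) = algebraMap ℂ _ (a.eval (n : ℂ)))
    {P : VarRing} (hP : Φ P = 0) (d : ℕ)
    (hd : ∀ m ∈ (specializeN n P).support, casimirWeight m ≤ d) :
    traceSubstitution n (∑ m ∈ P.support with casimirWeight m = d,
      MvPolynomial.monomial m ((P.coeff m).eval (n : ℂ))) = 0 := by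
  have hΦ : Φ P = ∑ m ∈ P.support,
      ((P.coeff m).eval (n : ℂ)) • Φ (MvPolynomial.monomial m 1) := by
    conv_lhs => rw [P.as_sum, map_sum]
    apply Finset.sum_congr rfl
    intro m _
    rw [← mul_one (P.coeff m), ← MvPolynomial.C_mul_monomial, map_mul, hC, mul_one,
      Algebra.algebraMap_eq_smul_one, smul_mul_assoc, one_mul]
  have hmon : ∀ m (a : ℂ), traceSubstitution n (MvPolynomial.monomial m a) =
      a • traceSubstitution n (MvPolynomial.monomial m 1) := by
    intro m a
    rw [← map_smul, MvPolynomial.smul_monomial, smul_eq_mul, mul_one]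
  have hsym : HasLeadingSymbol (Φ P) d (∑ m ∈ P.support, if casimirWeight m = d then
      traceSubstitution n (MvPolynomial.monomial m ((P.coeff m).eval (n : ℂ))) else 0) := by
    rw [hΦ]
    apply HasLeadingSymbol.sum
    intro m _
    -- A coefficient of `P` may vanish at `N = n`; `hd` does not bound the weight of such a
    -- monomial.
    by_cases h0 : (P.coeff m).eval (n : ℂ) = 0
    · simpa [h0] using HasLeadingSymbol.zero d
    have hm : casimirWeight m ≤ d := by
      apply hd
      rw [MvPolynomial.mem_support_iff, specializeN, MvPolynomial.coeff_map]
      exact h0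
    have hs := (hasLeadingSymbol_monomial hX m).smul ((P.coeff m).eval (n : ℂ))
    split_ifs with h
    · rw [hmon, ← h]
      exact hs
    · exact hs.of_lt (lt_of_le_of_ne hm h)
  rw [hP] at hsym
  rw [map_sum, Finset.sum_filter]
  apply hsym.eq_zero
  apply MvPolynomial.IsHomogeneous.sum
  intro m _
  split_ifs with h
  · rw [hmon, ← h, MvPolynomial.smul_eq_C_mul]
    simpa using (MvPolynomial.isHomogeneous_C _ ((P.coeff m).eval (n : ℂ))).mul
      (isHomogeneous_traceSubstitution (n := n) m)
  · exact MvPolynomial.isHomogeneous_zero _ _ _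

theorem eval_traceSubstitution_diagonal (a : Fin n → ℂ) (p : MvPolynomial ℕ+ ℂ) :
    MvPolynomial.eval (fun x : Fin n × Fin n => Matrix.diagonal a x.1 x.2)
      (traceSubstitution n p) = MvPolynomial.eval (fun k : ℕ+ => ∑ i, a i ^ (k : ℕ)) p := by
  have hmap : (coordinateMatrix n).map
      (MvPolynomial.eval fun x : Fin n × Fin n => Matrix.diagonal a x.1 x.2) =
      Matrix.diagonal a := by
    ext i j
    simp [coordinateMatrix]
  have h : ∀ k : ℕ, MvPolynomial.eval (fun x : Fin n × Fin n => Matrix.diagonal a x.1 x.2)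
      (coordinateMatrix n ^ k).trace = ∑ i, a i ^ k := by
    intro k
    rw [AddMonoidHom.map_trace, ← RingHom.mapMatrix_apply, map_pow, RingHom.mapMatrix_apply, hmap,
      Matrix.diagonal_pow, Matrix.trace_diagonal]
    rfl
  have hcomp : (MvPolynomial.eval fun x : Fin n × Fin n => Matrix.diagonal a x.1 x.2).comp
      (traceSubstitution n).toRingHom = MvPolynomial.eval fun k : ℕ+ => ∑ i, a i ^ (k : ℕ) :=
    MvPolynomial.ringHom_ext (fun r => by simp) fun k => by simp [traceSubstitution, h]
  exact DFunLike.congr_fun hcomp p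

/-- On diagonal matrices the traces become power sums, which take arbitrary values up to index `K`;
so `p` vanishes at every point. -/
theorem eq_zero_of_traceSubstitution_eq_zero {K : ℕ} {p : MvPolynomial ℕ+ ℂ}
    (hvars : ∀ k ∈ p.vars, (k : ℕ) ≤ K)
    (hn : ∀ y : ℕ → ℂ, ∃ a : Fin n → ℂ, ∀ j, 0 < j → j ≤ K → ∑ i, a i ^ j = y j)
    (hp : traceSubstitution n p = 0) : p = 0 := by
  apply MvPolynomial.funext
  intro y
  obtain ⟨a, ha⟩ := hn fun j => if h : 0 < j then y ⟨j, h⟩ else 0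
  have h := eval_traceSubstitution_diagonal a p
  rw [hp, map_zero] at h
  rw [map_zero, h]
  apply MvPolynomial.hom_congr_vars (by ext; simp) _ rfl
  intro k hk _
  rw [MvPolynomial.eval_X, MvPolynomial.eval_X, ha k k.pos (hvars k hk), dif_pos k.pos]
  rfl

/-- The realisations by differential operators for all `n` separate polynomials. -/
theorem eq_zero_of_forall_glOperator (Φ : ∀ n : ℕ, VarRing →+* Module.End ℂ (MatrixPoly n))
    (hX : ∀ n k, Φ n (MvPolynomial.X k) = (glOperator n ^ (k : ℕ)).trace)
    (hC : ∀ n (a : CoeffRing), Φ n (MvPolynomial.C a) = algebraMap ℂ _ (a.eval (n : ℂ)))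
    (P : VarRing) (hP : ∀ n, Φ n P = 0) : P = 0 := by
  obtain ⟨n₀, hn₀⟩ := exists_power_sums_eq (P.vars.sup fun k => (k : ℕ))
  have hspec : ∀ n ≥ n₀, specializeN n P = 0 := by
    intro n hn
    by_contra hne
    obtain ⟨m₀, hm₀, hmax⟩ := Finset.exists_max_image _ casimirWeight
      (Finset.nonempty_of_ne_empty (mt MvPolynomial.support_eq_empty.1 hne))
    have h0 := traceSubstitution_topComponent_eq_zero (hX n) (hC n) (hP n) _ hmax
    have h1 := eq_zero_of_traceSubstitution_eq_zero ?_ (hn₀ n hn) h0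
    · have h2 := congrArg (MvPolynomial.coeff m₀) h1
      rw [MvPolynomial.coeff_sum, MvPolynomial.coeff_zero] at h2
      rw [MvPolynomial.mem_support_iff, specializeN, MvPolynomial.coeff_map] at hm₀
      simp only [MvPolynomial.coeff_monomial] at h2
      rw [Finset.sum_ite_eq', if_pos] at h2
      · exact hm₀ h2
      · rw [Finset.mem_filter, MvPolynomial.mem_support_iff]
        refine ⟨fun h => hm₀ ?_, rfl⟩
        rw [h, map_zero]
    · intro k hk
      apply Finset.le_sup (f := fun k : ℕ+ => (k : ℕ))
      obtain ⟨m, hm, hk⟩ := MvPolynomial.mem_vars_iff_mem_support k |>.1 hk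
      refine (MvPolynomial.mem_vars_iff_mem_support k).2 ⟨m, ?_, hk⟩
      obtain ⟨m', hm', h⟩ := Finset.mem_biUnion.1 (MvPolynomial.support_sum hm)
      rw [Finset.mem_singleton.1 (MvPolynomial.support_monomial_subset h)]
      exact (Finset.mem_filter.1 hm').1
  ext1 m
  rw [MvPolynomial.coeff_zero]
  -- Each coefficient is a polynomial in `N` vanishing at all integers `n ≥ n₀`.
  apply Polynomial.eq_zero_of_infinite_isRoot
  apply Set.Infinite.mono (s := (fun n : ℕ => (n : ℂ)) '' Set.Ici n₀)
  · rintro _ ⟨n, hn, rfl⟩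
    have := congrArg (MvPolynomial.coeff m) (hspec n hn)
    rw [specializeN, MvPolynomial.coeff_map] at this
    exact this
  · exact (Set.Ici_infinite n₀).image Nat.cast_injective.injOn

end Separation

/-! ### Existence of the weight system -/

section Evaluation

variable {ι A : Type} [Fintype ι] [DecidableEq ι] [Ring A] {E : Matrix ι ι A}

theorem IsGlMatrix.commute_trace_pow (hE : IsGlMatrix E) (k l : ℕ) :
    Commute (E ^ k).trace (E ^ l).trace := by
  have h : ∀ l i j, Commute (E ^ k).trace ((E ^ l) i j) := by
    intro l
    induction l with
    | zero =>
      intro i j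
      rw [pow_zero, Matrix.one_apply]
      split_ifs
      · exact Commute.one_right _
      · exact Commute.zero_right _
    | succ l ih =>
      intro i j
      rw [pow_succ, Matrix.mul_apply]
      exact Commute.sum_right _ _ _ fun a _ =>
        (ih i a).mul_right ((hE.covariant_pow k).commute_trace a j).symm
  exact Commute.sum_right _ _ _ fun i _ => h l i i

variable [Algebra ℂ A]

open scoped IsMulCommutative in
/-- The elements `glSum E m α` form a solution of the relations in a commutative ring. -/
theorem IsGlMatrix.exists_commutative_solution (hE : IsGlMatrix E) :
    ∃ (R : Type) (_ : CommRing R) (_ : Algebra ℂ R) (f : R →ₐ[ℂ] A) (N : R) (c : ℕ+ → R)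
      (w : ∀ m : ℕ, Equiv.Perm (Fin m) → R), IsGlSystem N c w ∧ f N = (Fintype.card ι : A) ∧
        (∀ k : ℕ+, f (c k) = (E ^ (k : ℕ)).trace) ∧ ∀ m α, f (w m α) = glSum E m α := by
  -- Universal polynomials can be evaluated only in commutative rings; the traces commute, and they
  -- generate all the values.
  let S : Subalgebra ℂ A := Algebra.adjoin ℂ (Set.range fun k : ℕ => (E ^ k).trace)
  have hS : IsMulCommutative S := Algebra.isMulCommutative_adjoin ℂ (by
    rintro _ ⟨k, rfl⟩ _ ⟨l, rfl⟩
    exact hE.commute_trace_pow k l)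
  have hc : ∀ k : ℕ, (E ^ k).trace ∈ S := fun k => Algebra.subset_adjoin ⟨k, rfl⟩
  have hw : ∀ m α, glSum E m α ∈ S := fun m α =>
    hE.isGlSystem.mem_subring S.toSubring (natCast_mem _ _) (fun k => hc k) m α
  refine ⟨S, inferInstance, inferInstance, S.val, (Fintype.card ι : S), fun k => ⟨_, hc k⟩,
    fun m α => ⟨_, hw m α⟩, ?_, ?_, fun k => rfl, fun m α => rfl⟩
  · apply IsGlSystem.of_injective (R := A) (S.val : S →+* A) Subtype.val_injective
    convert hE.isGlSystem using 1
    · simp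
    · rfl
    · rfl
  · simp

/-- The homomorphism given by `N ↦ |ι|`, `C_k ↦ tr E^k`, under which the universal polynomials
become the elements `glSum E m α`. -/
theorem IsGlMatrix.exists_evaluation (hE : IsGlMatrix E) : ∃ Φ : VarRing →+* A,
    (∀ k : ℕ+, Φ (MvPolynomial.X k) = (E ^ (k : ℕ)).trace) ∧
    (∀ a : CoeffRing, Φ (MvPolynomial.C a) = algebraMap ℂ A (a.eval (Fintype.card ι : ℂ))) ∧
    ∀ m α, Φ (universalValue m α) = glSum E m α := by
  obtain ⟨R, _, _, f, N, c, w, h, hN, hc, hw⟩ := hE.exists_commutative_solution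
  refine ⟨(f : R →+* A).comp (glEval N c), fun k => ?_, fun a => ?_, fun m α => ?_⟩
  · simp [glEval_X, hc]
  · have : f (Polynomial.aeval N a) = Polynomial.aeval (Fintype.card ι : A) a := by
      rw [← hN, Polynomial.aeval_algHom_apply]
    rw [← map_natCast (algebraMap ℂ A), Polynomial.aeval_algebraMap_apply] at this
    simpa [glEval] using this
  · simp [glEval_universalValue h, hw]

end Evaluation

/-- The evaluation homomorphism for the realisation of `𝔤𝔩_n` by differential operators. -/
noncomputable def operatorEval (n : ℕ) : VarRing →+* Module.End ℂ (MatrixPoly n) :=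
  (isGlMatrix_glOperator n).exists_evaluation.choose

theorem operatorEval_X (n : ℕ) (k : ℕ+) :
    operatorEval n (MvPolynomial.X k) = (glOperator n ^ (k : ℕ)).trace :=
  (isGlMatrix_glOperator n).exists_evaluation.choose_spec.1 k

theorem operatorEval_C (n : ℕ) (a : CoeffRing) :
    operatorEval n (MvPolynomial.C a) = algebraMap ℂ _ (a.eval (n : ℂ)) := by
  have h : operatorEval n (MvPolynomial.C a) =
      algebraMap ℂ _ (a.eval (Fintype.card (Fin n) : ℂ)) :=
    (isGlMatrix_glOperator n).exists_evaluation.choose_spec.2.1 a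
  rwa [Fintype.card_fin] at h

theorem operatorEval_varN (n : ℕ) : operatorEval n varN = (n : Module.End ℂ (MatrixPoly n)) := by
  rw [varN, operatorEval_C, Polynomial.eval_X, map_natCast]

theorem operatorEval_universalValue (n m : ℕ) (α : Equiv.Perm (Fin m)) :
    operatorEval n (universalValue m α) = glSum (glOperator n) m α :=
  (isGlMatrix_glOperator n).exists_evaluation.choose_spec.2.2 m α

theorem eq_of_operatorEval_eq {P Q : VarRing} (h : ∀ n, operatorEval n P = operatorEval n Q) :
    P = Q := by
  rw [← sub_eq_zero]
  apply eq_zero_of_forall_glOperator operatorEval operatorEval_X operatorEval_C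
  intro n
  rw [map_sub, h, sub_self]

/-- The evaluations for all `n` together are injective and send the universal values to the sums
`glSum`, which satisfy the relations. -/
theorem isGlSystem_universal : IsGlSystem varN MvPolynomial.X universalValue := by
  have hs : IsGlSystem (R := ∀ n, Module.End ℂ (MatrixPoly n)) (fun n => (n : Module.End ℂ _))
      (fun k n => (glOperator n ^ (k : ℕ)).trace) fun m α n => glSum (glOperator n) m α := by
    have h : ∀ n, IsGlSystem (n : Module.End ℂ (MatrixPoly n)) _ _ := fun n => by
      simpa using (isGlMatrix_glOperator n).isGlSystem
    exact ⟨funext fun n => (h n).empty, fun _ _ _ _ => funext fun n => (h n).concat ..,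
      fun _ => funext fun n => (h n).cycle _,
      fun _ _ _ h1 h2 => funext fun n => (h n).recurrence _ _ _ h1 h2,
      fun _ _ _ h1 h2 => funext fun n => (h n).recurrence_adjacent _ _ _ h1 h2⟩
  apply IsGlSystem.of_injective (RingHom.pi operatorEval)
  · intro P Q h
    exact eq_of_operatorEval_eq fun n => congrFun h n
  · convert hs using 1
    · funext n
      exact operatorEval_varN n
    · funext k n
      exact operatorEval_X n k
    · funext m α n
      exact operatorEval_universalValue n m α

/-! ### The values on the inverse standard cycles -/

/-- The Casimir variables, with `C₀ = N`. -/
noncomputable def casimirVar (m : ℕ) : VarRing :=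
  if h : 0 < m then MvPolynomial.X ⟨m, h⟩ else varN

/-- The polynomial specialising to the trace of `(E - N)^m`. -/
noncomputable def shiftedCasimir (m : ℕ) : VarRing :=
  ∑ k ∈ Finset.range (m + 1), casimirVar k * (-varN) ^ (m - k) * (m.choose k : VarRing)

/-- The values of the weight system on the inverse standard cycles, with `N` for `m = 0`. -/
noncomputable def inverseCasimir (m : ℕ) : VarRing :=
  if 0 < m then universalValue m (finRotate m)⁻¹ else varN

theorem operatorEval_casimirVar (n m : ℕ) :
    operatorEval n (casimirVar m) = (glOperator n ^ m).trace := by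
  rw [casimirVar]
  split_ifs with h
  · exact operatorEval_X n ⟨m, h⟩
  · obtain rfl : m = 0 := by omega
    rw [operatorEval_varN, pow_zero, Matrix.trace_one, Fintype.card_fin]

theorem operatorEval_shiftedCasimir (n m : ℕ) : operatorEval n (shiftedCasimir m) =
    ((glOperator n - (n : Matrix (Fin n) (Fin n) (Module.End ℂ (MatrixPoly n)))) ^ m).trace := by
  rw [trace_sub_natCast_pow, shiftedCasimir, map_sum]
  simp only [map_mul, map_pow, map_neg, map_natCast, operatorEval_casimirVar, operatorEval_varN]

theorem operatorEval_inverseCasimir (n m : ℕ) :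
    operatorEval n (inverseCasimir m) = (oppositePow (glOperator n) m).trace := by
  rw [inverseCasimir]
  split_ifs with h
  · obtain ⟨m, rfl⟩ : ∃ k, m = k + 1 := ⟨m - 1, by omega⟩
    rw [operatorEval_universalValue, glSum_finRotate_inv]
  · obtain rfl : m = 0 := by omega
    rw [operatorEval_varN, oppositePow_zero, Matrix.trace_one, Fintype.card_fin]

theorem inverseCasimir_eq (m : ℕ) : inverseCasimir m = shiftedCasimir m +
    ∑ j ∈ Finset.range m, shiftedCasimir j * inverseCasimir (m - 1 - j) := by
  apply eq_of_operatorEval_eq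
  intro n
  have h := (isGlMatrix_glOperator n).trace_oppositePow m
  rw [Fintype.card_fin] at h
  rw [map_add, map_sum, operatorEval_inverseCasimir, h, operatorEval_shiftedCasimir]
  simp only [map_mul, operatorEval_inverseCasimir, operatorEval_shiftedCasimir]

/-! ### Power series with exponent `N` and Möbius substitutions -/

section Series

open PowerSeries

theorem constantCoeff_subst_of_zero {a : VarRing⟦X⟧} (ha : constantCoeff a = 0)
    (f : VarRing⟦X⟧) : constantCoeff (f.subst a) = constantCoeff f := by
  have hs : HasSubst a := HasSubst.of_constantCoeff_zero' ha
  have h : f = C (constantCoeff f) + (f - C (constantCoeff f)) := by ring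
  have h0 : constantCoeff ((f - C (constantCoeff f)).subst a) = 0 := by
    apply PowerSeries.constantCoeff_subst_eq_zero ha
    simp
  conv_lhs => rw [h]
  rw [subst_add hs, map_add, h0, add_zero]
  rw [show (C (constantCoeff f) : VarRing⟦X⟧).subst a = C (constantCoeff f) from subst_C _]
  simp

theorem coeff_one_eq_constantCoeff_derivative (f : VarRing⟦X⟧) :
    coeff 1 f = constantCoeff (d⁄dX VarRing f) := by
  rw [← coeff_zero_eq_constantCoeff_apply, coeff_derivative]
  simp

theorem coeff_one_subst {a : VarRing⟦X⟧} (ha : constantCoeff a = 0) (f : VarRing⟦X⟧) :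
    coeff 1 (f.subst a) = coeff 1 f * coeff 1 a := by
  have hs : HasSubst a := HasSubst.of_constantCoeff_zero' ha
  rw [coeff_one_eq_constantCoeff_derivative, derivative_subst hs, map_mul,
    constantCoeff_subst_of_zero ha, ← coeff_one_eq_constantCoeff_derivative,
    ← coeff_one_eq_constantCoeff_derivative]

theorem map_subst_eq (τ : VarRing →+* VarRing) {a : VarRing⟦X⟧} (ha : constantCoeff a = 0)
    (f : VarRing⟦X⟧) : PowerSeries.map τ (f.subst a) = (PowerSeries.map τ f).subst
      (PowerSeries.map τ a) :=
  PowerSeries.map_subst (HasSubst.of_constantCoeff_zero' ha) f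

/-- The binomial series `(1 + X)^N`. -/
noncomputable def binomialN : VarRing⟦X⟧ :=
  PowerSeries.binomialSeries VarRing (Polynomial.X : CoeffRing)

theorem coeff_binomialN (k : ℕ) :
    coeff k binomialN = MvPolynomial.C (Ring.choose (Polynomial.X : CoeffRing) k) := by
  rw [binomialN, binomialSeries_coeff, Algebra.smul_def, mul_one]
  rfl

theorem succ_mul_ring_choose (a : CoeffRing) (k : ℕ) :
    ((k : CoeffRing) + 1) * Ring.choose a (k + 1) = (a - k) * Ring.choose a k := by
  have h1 := Ring.descPochhammer_eq_factorial_smul_choose a (k + 1)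
  have h0 := Ring.descPochhammer_eq_factorial_smul_choose a k
  rw [descPochhammer_succ_right, Polynomial.smeval_mul, h0, Nat.factorial_succ] at h1
  simp only [nsmul_eq_mul, Polynomial.smeval_sub, Polynomial.smeval_X, Polynomial.smeval_natCast,
    pow_one, pow_zero, mul_one, Nat.cast_mul, Nat.cast_add, Nat.cast_one] at h1
  have hk : ((k.factorial : ℕ) : CoeffRing) ≠ 0 := Nat.cast_ne_zero.2 (Nat.factorial_ne_zero k)
  apply mul_left_cancel₀ hk
  linear_combination -h1

/-- This differential equation replaces the logarithm: the properties of `powN` involving products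
are derived from it. -/
theorem derivative_binomialN :
    (1 + X) * d⁄dX VarRing binomialN = C varN * binomialN := by
  have hc : ∀ k : ℕ, ((k : VarRing) + 1) * coeff (k + 1) binomialN =
      (varN - k) * coeff k binomialN := by
    intro k
    have := congrArg (MvPolynomial.C (σ := ℕ+)) (succ_mul_ring_choose Polynomial.X k)
    simpa [coeff_binomialN, varN] using this
  ext1 k
  rw [add_mul, one_mul, map_add, coeff_C_mul, coeff_derivative]
  cases k with
  | zero =>
    have := hc 0
    simp at this ⊢
    linear_combination this
  | succ k =>
    have := hc (k + 1)
    rw [coeff_succ_X_mul, coeff_derivative]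
    push_cast at this ⊢
    linear_combination this

theorem powN_eq (f : VarRing⟦X⟧) : powN f = binomialN.subst (f - 1) := rfl

theorem constantCoeff_powN {f : VarRing⟦X⟧} (hf : constantCoeff f = 1) :
    constantCoeff (powN f) = 1 := by
  rw [powN_eq, constantCoeff_subst_of_zero (by simp [hf]), binomialN,
    binomialSeries_constantCoeff]

theorem coeff_one_powN {f : VarRing⟦X⟧} (hf : constantCoeff f = 1) :
    coeff 1 (powN f) = varN * coeff 1 f := by
  rw [powN_eq, coeff_one_subst (by simp [hf]), coeff_binomialN, Ring.choose_one_right]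
  simp [varN, coeff_one]

theorem powN_subst {f a : VarRing⟦X⟧} (hf : constantCoeff f = 1) (ha : constantCoeff a = 0) :
    (powN f).subst a = powN (f.subst a) := by
  have hs : HasSubst a := HasSubst.of_constantCoeff_zero' ha
  rw [powN_eq, powN_eq, subst_comp_subst_apply
    (HasSubst.of_constantCoeff_zero' (by simp [hf])) hs, subst_sub hs]
  congr 2
  rw [← coe_substAlgHom hs, map_one]

theorem map_powN (τ : VarRing →ₐ[CoeffRing] VarRing) {f : VarRing⟦X⟧}
    (hf : constantCoeff f = 1) :
    PowerSeries.map (τ : VarRing →+* VarRing) (powN f) =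
      powN (PowerSeries.map (τ : VarRing →+* VarRing) f) := by
  rw [powN_eq, powN_eq, map_subst_eq _ (by simp [hf]), map_sub, map_one]
  congr 1
  ext1 k
  rw [coeff_map, coeff_binomialN]
  exact τ.commutes _

theorem derivative_powN {f : VarRing⟦X⟧} (hf : constantCoeff f = 1) :
    f * d⁄dX VarRing (powN f) = C varN * powN f * d⁄dX VarRing f := by
  have hs : HasSubst (f - 1) := HasSubst.of_constantCoeff_zero' (by simp [hf])
  have h := congrArg (subst (f - 1)) derivative_binomialN
  rw [subst_mul hs, subst_mul hs, subst_add hs, subst_X hs,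
    show (C varN : VarRing⟦X⟧).subst (f - 1) = C varN from subst_C _,
    show (1 : VarRing⟦X⟧).subst (f - 1) = 1 by rw [← coe_substAlgHom hs, map_one],
    add_sub_cancel] at h
  rw [powN_eq, derivative_subst hs, ← mul_assoc, h, map_sub]
  simp

theorem powN_mul_powN_of_mul_eq_one {f g : VarRing⟦X⟧} (hf : constantCoeff f = 1)
    (hg : constantCoeff g = 1) (hfg : f * g = 1) : powN f * powN g = 1 := by
  apply derivative.ext
  · have h1 := derivative_powN hf
    have h2 := derivative_powN hg
    have h3 := congrArg (d⁄dX VarRing) hfg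
    rw [Derivation.leibniz, smul_eq_mul, smul_eq_mul] at h3
    rw [Derivation.leibniz, smul_eq_mul, smul_eq_mul]
    have hone : d⁄dX VarRing (1 : VarRing⟦X⟧) = 0 := Derivation.map_one_eq_zero _
    rw [hone] at h3 ⊢
    linear_combination (g * powN g) * h1 + (f * powN f) * h2 +
      (C varN * powN f * powN g) * h3 -
      (powN f * d⁄dX VarRing (powN g) + powN g * d⁄dX VarRing (powN f)) * hfg
  · rw [map_mul, constantCoeff_powN hf, constantCoeff_powN hg]
    simp

/-- The series `u / (1 - c u)`. -/
noncomputable def moebius (c : VarRing) : VarRing⟦X⟧ := X * geomSeries c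

theorem geomSeries_mul (c : VarRing) : geomSeries c * (1 - C c * X) = 1 := by
  ext k
  rw [mul_sub, mul_one, map_sub, mul_comm (C c), ← mul_assoc, coeff_mul_C]
  cases k with
  | zero => simp [geomSeries]
  | succ k => simp [geomSeries, coeff_succ_mul_X, pow_succ, coeff_one]

theorem constantCoeff_geomSeries (c : VarRing) : constantCoeff (geomSeries c) = 1 := by
  rw [← coeff_zero_eq_constantCoeff_apply, geomSeries, coeff_mk, pow_zero]

theorem constantCoeff_moebius (c : VarRing) : constantCoeff (moebius c) = 0 := by
  simp [moebius]

theorem coeff_one_moebius (c : VarRing) : coeff 1 (moebius c) = 1 := by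
  rw [moebius, show (1 : ℕ) = 0 + 1 from rfl, coeff_succ_X_mul]
  simp [constantCoeff_geomSeries]

theorem hasSubst_moebius (c : VarRing) : HasSubst (moebius c) :=
  HasSubst.of_constantCoeff_zero' (constantCoeff_moebius c)

theorem moebius_mul (c : VarRing) : moebius c * (1 - C c * X) = X := by
  rw [moebius, mul_assoc, geomSeries_mul, mul_one]

theorem isUnit_one_sub_C_mul_X (c : VarRing) : IsUnit (1 - C c * X : VarRing⟦X⟧) :=
  IsUnit.of_mul_eq_one_right _ (geomSeries_mul c)

theorem eq_moebius {c : VarRing} {f : VarRing⟦X⟧} (h : f * (1 - C c * X) = X) : f = moebius c :=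
  (isUnit_one_sub_C_mul_X c).mul_right_cancel (h.trans (moebius_mul c).symm)

theorem subst_C_eq (c : VarRing) (a : VarRing⟦X⟧) : (C c : VarRing⟦X⟧).subst a = C c := subst_C _

theorem subst_one {a : VarRing⟦X⟧} (ha : HasSubst a) : (1 : VarRing⟦X⟧).subst a = 1 := by
  rw [← coe_substAlgHom ha, map_one]

theorem subst_one_sub_C_mul_X {a : VarRing⟦X⟧} (ha : HasSubst a) (c : VarRing) :
    (1 - C c * X : VarRing⟦X⟧).subst a = 1 - C c * a := by
  rw [subst_sub ha, subst_one ha, subst_mul ha, subst_C_eq, subst_X ha]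

/-- In the coordinate `1/u` the substitution `moebius c` is the translation by `-c`. -/
theorem moebius_subst_moebius (c d : VarRing) : (moebius c).subst (moebius d) =
    moebius (c + d) := by
  have hd := hasSubst_moebius d
  have h := congrArg (subst (moebius d)) (moebius_mul c)
  rw [subst_mul hd, subst_one_sub_C_mul_X hd, subst_X hd] at h
  apply eq_moebius
  have h2 := moebius_mul d
  rw [map_add]
  linear_combination (1 - C d * X) * h + (1 + (moebius c).subst (moebius d) * C c) * h2

theorem coeff_moebius_pow (c : VarRing) (k j : ℕ) : coeff (j + 1) (moebius c ^ (k + 1)) =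
    if k ≤ j then c ^ (j - k) * (j.choose k : VarRing) else 0 := by
  have hg : geomSeries c = rescale c (mk 1) := by
    ext i; simp [geomSeries, coeff_rescale]
  rw [moebius, mul_pow, coeff_X_pow_mul', hg, ← map_pow, mk_one_pow_eq_mk_choose_add,
    coeff_rescale, coeff_mk]
  by_cases h : k ≤ j
  · rw [if_pos h, if_pos (by omega)]
    congr 2
    · omega
    · congr 2; omega
  · rw [if_neg h, if_neg (by omega)]

/-- With `c = -N` this is the passage from `tr E^k` to `tr (E - N)^k` on generating series. -/
theorem X_mul_mk_subst_moebius (a : ℕ → VarRing) (c : VarRing) :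
    (X * mk a : VarRing⟦X⟧).subst (moebius c) =
      X * mk fun j => ∑ k ∈ Finset.range (j + 1), a k * c ^ (j - k) * (j.choose k : VarRing) := by
  have hz : constantCoeff (X * mk a : VarRing⟦X⟧) = 0 := by simp
  ext1 n
  cases n with
  | zero =>
    rw [coeff_zero_eq_constantCoeff_apply, coeff_zero_eq_constantCoeff_apply,
      constantCoeff_subst_of_zero (constantCoeff_moebius c)]
    simp
  | succ j =>
    rw [coeff_subst' (hasSubst_moebius c), coeff_succ_X_mul, coeff_mk,
      finsum_eq_sum_of_support_subset (s := Finset.range (j + 2)), Finset.sum_range_succ']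
    · rw [coeff_zero_eq_constantCoeff_apply, hz, zero_smul, add_zero]
      apply Finset.sum_congr rfl
      intro k hk
      rw [coeff_moebius_pow, if_pos (by simpa [Nat.lt_succ_iff] using hk), coeff_succ_X_mul,
        coeff_mk, smul_eq_mul, mul_assoc]
    · intro d hd
      by_contra hlt
      apply hd
      obtain ⟨k, rfl⟩ : ∃ k, d = k + 1 := ⟨d - 1, by simp at hlt; omega⟩
      dsimp only
      rw [coeff_moebius_pow, if_neg (by simp at hlt; omega), smul_zero]

end Series

/-! ### The symmetry of the Schur substitution -/

/-- The automorphism `S_k ↦ (-1)^k S_k`. -/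
noncomputable def parityMap : VarRing →ₐ[CoeffRing] VarRing :=
  MvPolynomial.aeval fun k : ℕ+ => (-1) ^ (k : ℕ) * MvPolynomial.X k

section Symmetry

open PowerSeries

/-- The automorphism of power series `f(u) ↦ (parityMap f)(-u)`. -/
noncomputable def parityRescale : VarRing⟦X⟧ →+* VarRing⟦X⟧ :=
  (rescale (-1)).comp (PowerSeries.map (parityMap : VarRing →+* VarRing))

theorem coeff_parityRescale (f : VarRing⟦X⟧) (k : ℕ) :
    coeff k (parityRescale f) = (-1) ^ k * parityMap (coeff k f) := by
  simp [parityRescale, coeff_rescale]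

theorem constantCoeff_parityRescale {f : VarRing⟦X⟧} (hf : constantCoeff f = 1) :
    constantCoeff (parityRescale f) = 1 := by
  rw [← coeff_zero_eq_constantCoeff_apply, coeff_parityRescale, coeff_zero_eq_constantCoeff_apply,
    hf, map_one, pow_zero, one_mul]

theorem hasSubst_neg_X : HasSubst ((-1 : VarRing) • X : VarRing⟦X⟧) := HasSubst.smul_X' _

theorem rescale_neg_one_subst {a : VarRing⟦X⟧} (ha : constantCoeff a = 0) (f : VarRing⟦X⟧) :
    rescale (-1) (f.subst a) = f.subst (rescale (-1) a) := by
  rw [rescale_eq_subst, rescale_eq_subst,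
    subst_comp_subst_apply (HasSubst.of_constantCoeff_zero' ha) hasSubst_neg_X]

theorem rescale_C_eq (r c : VarRing) : rescale r (C c) = C c := by
  ext1 k
  rw [coeff_rescale, coeff_C]
  split_ifs with h
  · rw [h, pow_zero, one_mul]
  · rw [mul_zero]

theorem rescale_neg_one_moebius (c : VarRing) : rescale (-1) (moebius c) = -moebius (-c) := by
  rw [neg_eq_iff_eq_neg.symm]
  apply eq_moebius
  have h := congrArg (rescale (-1)) (moebius_mul c)
  simp only [map_mul, map_sub, map_one, rescale_X, rescale_C_eq, map_neg] at h
  simp only [map_neg]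
  linear_combination -h

theorem parityMap_halfNSubOne : parityMap halfNSubOne = halfNSubOne := parityMap.commutes _

theorem parityMap_halfNAddOne : parityMap halfNAddOne = halfNAddOne := parityMap.commutes _

theorem map_moebius {c : VarRing} (hc : parityMap c = c) :
    PowerSeries.map (parityMap : VarRing →+* VarRing) (moebius c) = moebius c := by
  rw [moebius, map_mul, map_X]
  congr 1
  ext1 k
  simp [geomSeries, hc]

theorem map_schurSeries :
    PowerSeries.map (parityMap : VarRing →+* VarRing) schurSeries = rescale (-1) schurSeries := by
  ext1 k
  rw [coeff_map, coeff_rescale, schurSeries, coeff_mk]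
  split_ifs with h
  · exact MvPolynomial.aeval_X _ _
  · obtain rfl : k = 0 := by omega
    simp

/-- Under `u ↦ -u` the series `u / (1 - c u)` becomes `-u / (1 + c u)`; the sign of its `i`-th power
cancels that of `S_i`. -/
theorem parityRescale_schurSeries_subst {c : VarRing} (hc : parityMap c = c) :
    parityRescale (schurSeries.subst (moebius c)) = schurSeries.subst (moebius (-c)) := by
  have h0 := constantCoeff_moebius c
  have hs : HasSubst (-moebius (-c)) :=
    HasSubst.of_constantCoeff_zero' (by simp [constantCoeff_moebius])
  rw [parityRescale, RingHom.comp_apply, map_subst_eq _ h0, map_moebius hc, map_schurSeries,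
    rescale_neg_one_subst h0, rescale_neg_one_moebius, rescale_eq_subst,
    subst_comp_subst_apply hasSubst_neg_X hs, subst_smul hs, subst_X hs]
  simp

theorem parityRescale_powN {f : VarRing⟦X⟧} (hf : constantCoeff f = 1) :
    parityRescale (powN f) = powN (parityRescale f) := by
  have h1 : constantCoeff (PowerSeries.map (parityMap : VarRing →+* VarRing) f) = 1 := by
    rw [← coeff_zero_eq_constantCoeff_apply, coeff_map, coeff_zero_eq_constantCoeff_apply, hf]
    exact map_one _
  rw [parityRescale, RingHom.comp_apply, RingHom.comp_apply, map_powN _ hf, rescale_eq_subst,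
    powN_subst h1 (a := (-1 : VarRing) • X)
      (by rw [smul_eq_C_mul, map_mul, constantCoeff_X, mul_zero]), rescale_eq_subst]

theorem halfNAddOne_sub : halfNAddOne - halfNSubOne = 1 := by
  rw [halfNAddOne, halfNSubOne, ← map_sub, ← mul_sub, add_sub_sub_cancel, ← map_one MvPolynomial.C]
  congr 1
  rw [show (1 : CoeffRing) + 1 = Polynomial.C 2 by rw [← one_add_one_eq_two]; simp, ← map_mul]
  norm_num

theorem halfNAddOne_add : halfNAddOne + halfNSubOne = varN := by
  rw [halfNAddOne, halfNSubOne, varN, ← map_add, ← mul_add]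
  congr 1
  rw [show (Polynomial.X + 1 + (Polynomial.X - 1) : CoeffRing) = Polynomial.C 2 * Polynomial.X by
    rw [show (Polynomial.C 2 : CoeffRing) = 2 from rfl]; ring, ← mul_assoc, ← map_mul]
  norm_num

/-- The base of the power with exponent `N` in `casimirSeries`. -/
noncomputable def casimirBase : VarRing⟦X⟧ :=
  (1 - C halfNAddOne * X) * geomSeries halfNSubOne

theorem constantCoeff_casimirBase : constantCoeff casimirBase = 1 := by
  simp [casimirBase, constantCoeff_geomSeries]

theorem casimirBase_mul : casimirBase * (1 - C halfNSubOne * X) = 1 - C halfNAddOne * X := by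
  rw [casimirBase, mul_assoc, geomSeries_mul, mul_one]

theorem parityRescale_C {c : VarRing} (hc : parityMap c = c) :
    parityRescale (C c) = C c := by
  simp [parityRescale, hc, rescale_C_eq]

theorem parityRescale_X : parityRescale X = -X := by
  rw [parityRescale, RingHom.comp_apply, map_X, rescale_X, map_neg, map_one]
  ring

/-- With `p, q = (N ± 1)/2` the first factor is `(1 + p u)/(1 + q u)`. Since `p + q = N`, the
substitution `u ↦ u/(1 + N u)` turns `(1 - p u)/(1 - q u)` into its inverse. -/
theorem parityRescale_casimirBase_mul :
    parityRescale casimirBase * casimirBase.subst (moebius (-varN)) = 1 := by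
  have hs := hasSubst_moebius (-varN)
  have h1 := congrArg parityRescale casimirBase_mul
  rw [map_mul, map_sub, map_sub, map_one, map_mul, map_mul, parityRescale_X,
    parityRescale_C parityMap_halfNAddOne, parityRescale_C parityMap_halfNSubOne] at h1
  have h2 := congrArg (subst (moebius (-varN))) casimirBase_mul
  rw [subst_mul hs, subst_one_sub_C_mul_X hs, subst_one_sub_C_mul_X hs] at h2
  have h3 := moebius_mul (-varN)
  have u1 : IsUnit (1 - C (-halfNAddOne) * X : VarRing⟦X⟧) := isUnit_one_sub_C_mul_X _
  have u2 : IsUnit (1 - C (-halfNSubOne) * X : VarRing⟦X⟧) := isUnit_one_sub_C_mul_X _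
  apply (u1.mul u2).mul_right_cancel
  have hN : (C varN : VarRing⟦X⟧) = C halfNAddOne + C halfNSubOne := by
    rw [← map_add, halfNAddOne_add]
  have h4 : casimirBase.subst (moebius (-varN)) * (1 + C halfNAddOne * X) =
      1 + C halfNSubOne * X := by
    simp only [map_neg] at h3
    set Y := moebius (-varN)
    set Z := casimirBase.subst Y
    linear_combination (1 + C varN * X) * h2 + (C halfNSubOne * Z - C halfNAddOne) * h3 -
      (Z * X - X) * hN
  simp only [map_neg]
  linear_combination casimirBase.subst (moebius (-varN)) * (1 + C halfNAddOne * X) * h1 +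
    (1 + C halfNAddOne * X) * h4

/-- The series `1 + ∑ S_i (u / (1 - c u))^i`. -/
noncomputable def shiftedSchur (c : VarRing) : VarRing⟦X⟧ := schurSeries.subst (moebius c)

theorem constantCoeff_shiftedSchur (c : VarRing) : constantCoeff (shiftedSchur c) = 1 := by
  rw [shiftedSchur, constantCoeff_subst_of_zero (constantCoeff_moebius c),
    ← coeff_zero_eq_constantCoeff_apply, schurSeries, coeff_mk]
  simp

theorem coeff_one_shiftedSchur (c : VarRing) :
    coeff 1 (shiftedSchur c) = MvPolynomial.X 1 := by
  rw [shiftedSchur, coeff_one_subst (constantCoeff_moebius c), coeff_one_moebius, mul_one,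
    schurSeries, coeff_mk, dif_pos one_pos]
  rfl

theorem casimirSeries_eq : casimirSeries = powN casimirBase * shiftedSchur halfNSubOne *
    invOfUnit (shiftedSchur halfNAddOne) 1 := rfl

theorem shiftedSchur_mul_inv (c : VarRing) : shiftedSchur c * invOfUnit (shiftedSchur c) 1 = 1 :=
  mul_invOfUnit _ _ (by rw [constantCoeff_shiftedSchur]; rfl)

theorem shiftedSchur_subst (c d : VarRing) :
    (shiftedSchur c).subst (moebius d) = shiftedSchur (c + d) := by
  rw [shiftedSchur, subst_comp_subst_apply (hasSubst_moebius c) (hasSubst_moebius d),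
    moebius_subst_moebius, shiftedSchur]

/-- Write `F_c` for `shiftedSchur c` and `p, q = (N ± 1)/2`. Parity turns `F_q / F_p` into `F_{-q} /
F_{-p}`, and the shift by `-N` turns it into `F_{-p} / F_{-q}`; the powers with exponent `N` are
inverse as well. -/
theorem parityRescale_casimirSeries_mul :
    parityRescale casimirSeries * casimirSeries.subst (moebius (-varN)) = 1 := by
  have hs := hasSubst_moebius (-varN)
  have e1 := congrArg parityRescale (shiftedSchur_mul_inv halfNAddOne)
  have e2 := congrArg (subst (moebius (-varN))) (shiftedSchur_mul_inv halfNAddOne)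
  have e5 : parityRescale (shiftedSchur halfNAddOne) = shiftedSchur (-halfNAddOne) :=
    parityRescale_schurSeries_subst parityMap_halfNAddOne
  rw [map_mul, map_one, e5] at e1
  rw [subst_mul hs, subst_one hs, shiftedSchur_subst] at e2
  have e3 := powN_mul_powN_of_mul_eq_one (constantCoeff_parityRescale constantCoeff_casimirBase)
    (by rw [constantCoeff_subst_of_zero (constantCoeff_moebius _), constantCoeff_casimirBase])
    parityRescale_casimirBase_mul
  rw [casimirSeries_eq, map_mul, map_mul, subst_mul hs, subst_mul hs,
    parityRescale_powN constantCoeff_casimirBase,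
    powN_subst constantCoeff_casimirBase (constantCoeff_moebius _), shiftedSchur_subst]
  have a1 : halfNAddOne + -varN = -halfNSubOne := by rw [← halfNAddOne_add]; ring
  have a2 : halfNSubOne + -varN = -halfNAddOne := by rw [← halfNAddOne_add]; ring
  rw [a1] at e2
  have e4 : parityRescale (shiftedSchur halfNSubOne) = shiftedSchur (-halfNSubOne) :=
    parityRescale_schurSeries_subst parityMap_halfNSubOne
  rw [e4, a2]
  linear_combination (shiftedSchur (-halfNSubOne) *
      parityRescale (invOfUnit (shiftedSchur halfNAddOne) 1) * shiftedSchur (-halfNAddOne) *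
      (invOfUnit (shiftedSchur halfNAddOne) 1).subst (moebius (-varN))) * e3 +
    (shiftedSchur (-halfNSubOne) *
      (invOfUnit (shiftedSchur halfNAddOne) 1).subst (moebius (-varN))) * e1 + e2

theorem constantCoeff_casimirSeries : constantCoeff casimirSeries = 1 := by
  rw [casimirSeries_eq, map_mul, map_mul, constantCoeff_powN constantCoeff_casimirBase,
    constantCoeff_shiftedSchur, constantCoeff_invOfUnit]
  simp

theorem coeff_one_mul (f g : VarRing⟦X⟧) : coeff 1 (f * g) =
    coeff 1 f * constantCoeff g + constantCoeff f * coeff 1 g := by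
  rw [coeff_mul, Finset.Nat.sum_antidiagonal_eq_sum_range_succ_mk, Finset.sum_range_succ,
    Finset.sum_range_one]
  simp
  ring

/-- The two contributions of `S_1` cancel. This is what makes the convention `C₀ = N` compatible
with the substitution. -/
theorem coeff_one_casimirSeries : coeff 1 casimirSeries = -varN := by
  have hbase : coeff 1 casimirBase = -1 := by
    have h := congrArg (coeff 1) casimirBase_mul
    rw [coeff_one_mul, constantCoeff_casimirBase] at h
    simp [coeff_one] at h
    linear_combination h - halfNAddOne_sub
  have h := congrArg (coeff 1) (shiftedSchur_mul_inv halfNAddOne)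
  rw [coeff_one_mul, coeff_one_shiftedSchur, constantCoeff_shiftedSchur, constantCoeff_invOfUnit]
    at h
  rw [casimirSeries_eq, coeff_one_mul, coeff_one_mul, coeff_one_powN constantCoeff_casimirBase,
    hbase, map_mul, constantCoeff_powN constantCoeff_casimirBase, constantCoeff_shiftedSchur,
    constantCoeff_invOfUnit, coeff_one_shiftedSchur]
  simp [coeff_one] at h ⊢
  linear_combination h

theorem schurSubstitution_varN : schurSubstitution varN = varN := schurSubstitution.commutes _

theorem casimirSeries_eq_one_sub :
    casimirSeries = 1 - X * mk fun m => schurSubstitution (casimirVar m) := by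
  ext1 k
  rcases k with _ | _ | k
  · rw [coeff_zero_eq_constantCoeff_apply, constantCoeff_casimirSeries]
    simp
  · rw [map_sub, coeff_succ_X_mul, zero_add, coeff_one_casimirSeries, coeff_mk, casimirVar,
      dif_neg (lt_irrefl 0), schurSubstitution_varN]
    simp [coeff_one]
  · rw [map_sub, coeff_succ_X_mul, coeff_mk, casimirVar, dif_pos (Nat.succ_pos k),
      schurSubstitution]
    have h := MvPolynomial.aeval_X (R := CoeffRing) casimirInSchur ⟨k + 1, Nat.succ_pos k⟩
    refine Eq.trans ?_ (congrArg (coeff (k + 1 + 1) (1 : VarRing⟦X⟧) - ·) h.symm)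
    simp [casimirInSchur, coeff_one]

theorem schurSubstitution_inverseCasimir (m : ℕ) : schurSubstitution (inverseCasimir m) =
    (-1) ^ m * parityMap (schurSubstitution (casimirVar m)) := by
  set D : VarRing⟦X⟧ := mk fun m => schurSubstitution (inverseCasimir m) with hD
  set T : VarRing⟦X⟧ := mk fun m => schurSubstitution (shiftedCasimir m) with hT
  have h1 : (1 + X * D) * (1 - X * T) = 1 := by
    have h : D = T + X * (T * D) := by
      ext1 k
      rw [map_add, hD, hT, coeff_mk, coeff_mk, inverseCasimir_eq, map_add, map_sum]
      congr 1
      cases k with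
      | zero => simp
      | succ k =>
        rw [coeff_succ_X_mul, coeff_mul, Finset.Nat.sum_antidiagonal_eq_sum_range_succ_mk]
        simp
    linear_combination X * h
  have hsub : casimirSeries.subst (moebius (-varN)) = 1 - X * T := by
    have hs := hasSubst_moebius (-varN)
    rw [casimirSeries_eq_one_sub, subst_sub hs, subst_one hs, X_mul_mk_subst_moebius]
    congr 3
    funext j
    rw [shiftedCasimir, map_sum]
    simp [schurSubstitution_varN]
  have h2 := parityRescale_casimirSeries_mul
  rw [hsub] at h2
  have hu : IsUnit (1 - X * T) := IsUnit.of_mul_eq_one_right _ h1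
  -- Both `1 + X * D` and `parityRescale casimirSeries` are inverse to `1 - X * T`.
  have h3 := congrArg (coeff (m + 1)) (hu.mul_right_cancel (h1.trans h2.symm))
  rw [map_add, coeff_succ_X_mul, hD, coeff_mk, coeff_parityRescale, casimirSeries_eq_one_sub,
    map_sub, coeff_succ_X_mul, coeff_mk] at h3
  simp only [coeff_one, Nat.succ_ne_zero, if_false, zero_add, zero_sub, map_neg] at h3
  rw [h3]
  ring

end Symmetry

/-! ### Inversion of permutations -/

theorem neighborSwap_castSucc_succAbove {m : ℕ} (k x : Fin m) :
    neighborSwap k (k.castSucc.succAbove x) = k.succ.succAbove x := by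
  by_cases h : x = k
  · subst h; simp [neighborSwap_succ]
  · rw [castSucc_succAbove_of_ne h, neighborSwap_succAbove h]

theorem deleteLeg_succ_conj {m : ℕ} (k : Fin m) (σ : Equiv.Perm (Fin (m + 1))) :
    deleteLeg k.succ (neighborSwap k * σ * neighborSwap k) = deleteLeg k.castSucc σ := by
  have hss : ∀ x, neighborSwap k (neighborSwap k x) = x := fun x =>
    DFunLike.congr_fun (neighborSwap_mul_self k) x
  symm
  rw [eq_deleteLeg_iff]
  intro x
  rw [← neighborSwap_castSucc_succAbove, succAbove_deleteLeg, ← neighborSwap_castSucc_succAbove,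
    ← neighborSwap_castSucc]
  simp only [Equiv.Perm.coe_mul, Function.comp_apply, hss, EmbeddingLike.apply_eq_iff_eq]
  split_ifs <;> rfl

theorem deleteLeg_castSucc_conj {m : ℕ} (k : Fin m) (σ : Equiv.Perm (Fin (m + 1))) :
    deleteLeg k.castSucc (neighborSwap k * σ * neighborSwap k) = deleteLeg k.succ σ := by
  rw [← deleteLeg_succ_conj, neighborSwap_conj_conj]

theorem inv_neighborSwap_conj {m : ℕ} (k : Fin m) (α : Equiv.Perm (Fin (m + 1))) :
    (neighborSwap k * α * neighborSwap k)⁻¹ = neighborSwap k * α⁻¹ * neighborSwap k := by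
  rw [mul_inv_rev, mul_inv_rev, neighborSwap_inv, mul_assoc]

theorem inv_mul_neighborSwap {m : ℕ} (k : Fin m) (α : Equiv.Perm (Fin (m + 1))) :
    (α * neighborSwap k)⁻¹ = neighborSwap k * (α⁻¹ * neighborSwap k) * neighborSwap k := by
  rw [mul_inv_rev, neighborSwap_inv, mul_assoc, mul_assoc, neighborSwap_mul_self, mul_one]

theorem IsGlSystem.congr {R : Type*} [CommRing R] {N N' : R} {c c' : ℕ+ → R}
    {w : ∀ m : ℕ, Equiv.Perm (Fin m) → R} (h : IsGlSystem N c w) (hN : N = N') (hc : c = c') :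
    IsGlSystem N' c' w := by
  rwa [← hN, ← hc]

/-- Inverting permutations, with the sign `(-1)^m`, preserves solutions of the relations up to a
change of the values on the standard cycles. -/
theorem IsGlSystem.inverse {R : Type*} [CommRing R] {N : R} {c : ℕ+ → R}
    {w : ∀ m : ℕ, Equiv.Perm (Fin m) → R} (h : IsGlSystem N c w) :
    IsGlSystem N (fun k => (-1) ^ (k : ℕ) * w k (finRotate k)⁻¹)
      fun m α => (-1) ^ m * w m α⁻¹ where
  empty := by simp [h.empty]
  concat m n α β := by
    rw [concatPerm_inv, h.concat, pow_add]
    ring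
  cycle m := rfl
  recurrence m α k h1 h2 := by
    -- Inversion exchanges the two terms on the right-hand side; the resulting sign is absorbed by
    -- the drop in length from `m + 1` to `m`.
    have e := h.recurrence m α⁻¹ k (fun h' => h2 (by rw [← h', Equiv.Perm.inv_def, Equiv.apply_symm_apply]))
      fun h' => h1 (by rw [← h', Equiv.Perm.inv_def, Equiv.apply_symm_apply])
    rw [inv_neighborSwap_conj, ← deleteLeg_inv, ← deleteLeg_inv, inv_mul_neighborSwap,
      deleteLeg_succ_conj, deleteLeg_castSucc_conj, pow_succ]
    linear_combination (-(-1) ^ m) * e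
  recurrence_adjacent m α k h1 h2 := by
    -- In `α⁻¹` the arrow goes from `k` to `k + 1`, so relation 4 is used for its conjugate. This
    -- reverses the left-hand side; the sign is compensated by the new value `-c 1` and by the
    -- parity of the lengths.
    set σ := neighborSwap k * α⁻¹ * neighborSwap k with hσ
    have hα : α⁻¹ k.castSucc = k.succ := by rw [← h1, Equiv.Perm.inv_def, Equiv.symm_apply_apply]
    have s1 : σ k.succ = k.castSucc := by
      rw [hσ, Equiv.Perm.mul_apply, neighborSwap_succ, Equiv.Perm.mul_apply, hα, neighborSwap_succ]
    have s2 : σ k.castSucc ≠ k.succ := by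
      intro h'
      rw [hσ, Equiv.Perm.mul_apply, neighborSwap_castSucc, Equiv.Perm.mul_apply] at h'
      have h3 := (neighborSwap k).injective (h'.trans (neighborSwap_castSucc k).symm)
      exact h2 (by rw [← h3, Equiv.Perm.inv_def, Equiv.apply_symm_apply])
    have e := h.recurrence_adjacent m σ k s1 s2
    have hdel : deleteLeg k.succ σ = (deleteLeg k.succ α)⁻¹ := by
      rw [← deleteLeg_mul_neighborSwap σ k s1, ← deleteLeg_mul_neighborSwap α k h1,
        ← deleteLeg_inv, hσ, mul_assoc (neighborSwap k * α⁻¹), neighborSwap_mul_self, mul_one,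
        mul_inv_rev, neighborSwap_inv]
    have hone : w 1 (finRotate 1)⁻¹ = c 1 := by
      rw [show (finRotate 1)⁻¹ = finRotate 1 from Subsingleton.elim _ _]
      exact h.cycle 1
    have hc : (-1) ^ ((1 : ℕ+) : ℕ) * w (1 : ℕ+) (finRotate (1 : ℕ+))⁻¹ = -c 1 := by
      change (-1) ^ 1 * w 1 (finRotate 1)⁻¹ = -c 1
      rw [hone, pow_one, neg_one_mul]
    rw [hdel, deleteLeg_inv, hσ, neighborSwap_conj_conj] at e
    rw [inv_neighborSwap_conj, hc, ← hσ, pow_succ, pow_succ]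
    linear_combination (-(-1) ^ m) * e

/-! ### The main theorem -/

theorem parityMap_parityMap (P : VarRing) : parityMap (parityMap P) = P := by
  have h : parityMap.comp parityMap = AlgHom.id CoeffRing VarRing := by
    apply MvPolynomial.algHom_ext
    intro k
    simp only [AlgHom.comp_apply, parityMap, MvPolynomial.aeval_X, map_mul, map_pow, map_neg,
      map_one, AlgHom.id_apply]
    rw [← mul_assoc, ← mul_pow, show (-1 * -1 : VarRing) = 1 by ring, one_pow, one_mul]
  exact DFunLike.congr_fun h P

theorem neg_one_pow_pow_eq_ite {R : Type*} [CommRing R] (k e : ℕ) :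
    ((-1 : R) ^ k) ^ e = (-1) ^ (if Odd k then e else 0) := by
  split_ifs with h
  · rw [h.neg_one_pow]
  · rw [(Nat.not_odd_iff_even.1 h).neg_one_pow, one_pow, pow_zero]

theorem parityMap_monomial (d : ℕ+ →₀ ℕ) (a : CoeffRing) :
    parityMap (MvPolynomial.monomial d a) =
      MvPolynomial.monomial d ((-1) ^ oddIndexedDegree d * a) := by
  have hs : ∀ k : ℕ+, ∀ e : ℕ, ((-1 : VarRing) ^ (k : ℕ)) ^ e =
      (-1) ^ (if Odd (k : ℕ) then e else 0) := fun k e =>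
    neg_one_pow_pow_eq_ite (R := VarRing) k e
  rw [parityMap, MvPolynomial.aeval_monomial, MvPolynomial.monomial_eq, oddIndexedDegree,
    Finsupp.prod, Finsupp.prod, Finsupp.sum, map_mul, map_pow, map_neg, map_one,
    ← Finset.prod_pow_eq_pow_sum]
  simp only [mul_pow, Finset.prod_mul_distrib, hs]
  rw [mul_left_comm, mul_assoc]
  rfl

theorem coeff_parityMap (d : ℕ+ →₀ ℕ) (P : VarRing) :
    MvPolynomial.coeff d (parityMap P) = (-1) ^ oddIndexedDegree d * MvPolynomial.coeff d P := by
  induction P using MvPolynomial.induction_on' with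
  | monomial d' a =>
    rw [parityMap_monomial, MvPolynomial.coeff_monomial, MvPolynomial.coeff_monomial]
    split_ifs with h
    · rw [h]
    · rw [mul_zero]
  | add p q hp hq => rw [map_add, MvPolynomial.coeff_add, MvPolynomial.coeff_add, hp, hq, mul_add]

/-- Both sides solve the relations with the same `N` and, by `schurSubstitution_inverseCasimir`, the
same values on standard cycles. -/
theorem schurSubstitution_universalValue (m : ℕ) (α : Equiv.Perm (Fin m)) :
    schurSubstitution (universalValue m α) =
      (-1) ^ m * parityMap (schurSubstitution (universalValue m α⁻¹)) := by
  have h1 := isGlSystem_universal.map (schurSubstitution : VarRing →+* VarRing)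
  have h2 := (h1.map (parityMap : VarRing →+* VarRing)).inverse
  have hN : parityMap (schurSubstitution varN) = schurSubstitution varN := by
    rw [schurSubstitution_varN]
    exact parityMap.commutes _
  have hc : (fun k : ℕ+ => (-1) ^ (k : ℕ) *
      parityMap (schurSubstitution (universalValue k (finRotate k)⁻¹))) =
      fun k => schurSubstitution (MvPolynomial.X k) := by
    funext k
    have h := schurSubstitution_inverseCasimir k
    rw [inverseCasimir, if_pos k.pos, casimirVar, dif_pos k.pos] at h
    rw [h, map_mul, map_pow, map_neg, map_one, parityMap_parityMap, ← mul_assoc, ← mul_pow,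
      show (-1 * -1 : VarRing) = 1 by ring, one_pow, one_mul]
    rfl
  have h3 := h1.unique (w' := fun m α => (-1) ^ m *
    parityMap (schurSubstitution (universalValue m α⁻¹))) (h2.congr hN hc)
  exact congrFun (congrFun h3 m) α

theorem even_of_fixedPointFree_involution {m : ℕ} {α : Equiv.Perm (Fin m)}
    (h : Function.Involutive α) (hfix : ∀ i, α i ≠ i) : Even m := by
  have h2 : α ^ 2 = 1 := by
    ext1 i
    rw [pow_two]
    exact h i
  have hd := Equiv.Perm.two_dvd_card_support h2
  have hs : α.support = Finset.univ := by
    ext i; simp [hfix i]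
  rw [hs, Finset.card_univ, Fintype.card_fin] at hd
  exact even_iff_two_dvd.2 hd

theorem mainTheorem4 :
    (∃! w : ∀ m : ℕ, Equiv.Perm (Fin m) → VarRing, IsGlWeightSystem w) ∧
    ∀ w : ∀ m : ℕ, Equiv.Perm (Fin m) → VarRing, IsGlWeightSystem w →
      ∀ (m : ℕ) (α : Equiv.Perm (Fin m)), Function.Involutive α → (∀ i, α i ≠ i) →
        ∀ d ∈ (schurSubstitution (w m α)).support, ¬ Odd (oddIndexedDegree d) := by
  have huniq : ∀ w, IsGlWeightSystem w → w = universalValue := fun w hw =>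
    ((isGlWeightSystem_iff w).1 hw).unique isGlSystem_universal
  refine ⟨⟨universalValue, (isGlWeightSystem_iff _).2 isGlSystem_universal, huniq⟩, ?_⟩
  intro w hw m α hα hfix d hd hodd
  rw [huniq w hw, MvPolynomial.mem_support_iff] at hd
  apply hd
  have hinv : α⁻¹ = α := by
    rw [inv_eq_iff_mul_eq_one]
    ext1 i
    exact hα i
  have hm : (-1 : VarRing) ^ m = 1 :=
    Even.neg_one_pow (α := VarRing) (even_of_fixedPointFree_involution hα hfix)
  -- The coefficient of a monomial of odd parity equals its own negative.
  have h := congrArg (MvPolynomial.coeff d) (schurSubstitution_universalValue m α)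
  rw [hinv, hm, one_mul, coeff_parityMap,
    hodd.neg_one_pow, neg_one_mul] at h
  exact self_eq_neg.1 h
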